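/- Let $E$ be a (real) Banach lattice, with norm dual $E'$ and norm bidual $E''$ (ordered as dual and bidual), and regard $E$ as a subspace of $E''$ through the canonical embedding. For $v\in (E'')^+$ let $[-v,v]=\{w\in E'' : -v\le w\le v\}$. Conventions. For $A\subset E$, $\mathrm{sol}(A)=\{x\in E : |x|\le |y| \text{ for some } y\in A\}$. A net $(x_\alpha)$ in $E$ is uaw-convergent to $x$, written $x_\alpha\overset{uaw}{\longrightarrow}x$, if $|x_\alpha-x|\wedge u\to 0$ weakly for every $u\in E^+$. A norm bounded set $A\subset E$ is uaw-compact (resp. relatively uaw-compact) if every net in $A$ has a subnet that is uaw-convergent to a point of $A$ (resp. of $E$). A norm bounded set $A\subset E$ is L-weakly compact if $\|x_n\|\to 0$ for every disjoint sequence $(x_n)$ in $\mathrm{sol}(A)$. For a norm bounded set $\mathcal S\subset E$, a bounded operator $T:E\to Y$ into a Banach space is $\mathcal S$-L-weakly compact if $\|T(x_n)\|\to 0$ for every uaw-null sequence $(x_n)$ in $\mathrm{sol}(\mathcal S)$. A set $A\subset E$ is b-order bounded if $A\subset[-v,v]$ for some $v\in(E'')^+$, and b-semi compact if for every $\varepsilon>0$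 there is $v\in (E'')^+$ with $A\subset [-v,v]+\varepsilon B_{E''}$, where $B_{E''}$ is the closed unit ball of $E''$. $E$ is a KB-space if every norm bounded increasing sequence in $E^+$ is norm convergent. The following statements are equivalent: 1. $E$ is a KB-space. 2. Every b-semi compact subset of $E$ is L-weakly compact. 3. For every $v\in (E'')^+$, $\mathrm{Id}_E$ is $([-v,v]\cap E)$-L-weakly compact. 4. For every $\varepsilon>0$ and every $v\in (E'')^+$ there exist $g\in (E')^+$ and $u\in E^+$ such that $\|x\|\le g(|x|\wedge u)+\varepsilon$ for all $x\in[-v,v]\cap E$. 5. For every $v\in (E'')^+$ and every net $(x_\alpha)$ in $[-v,v]\cap E$ with $x_\alpha\overset{uaw}{\longrightarrow}0$, we have $\|x_\alpha\|\to 0$. 6. For every $v\in (E'')^+$ and every sequence $(x_n)$ in $[-v,v]\cap E$ with $x_n\overset{uaw}{\longrightarrow}0$, we have $\|x_n\|\to 0$. 7. Every b-order bounded uaw-compact subset of $E$ is norm compact. 8. Every b-order bounded relatively uaw-compact subset of $E$ is relatively norm compact. -/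

import Mathlib

open Filter Topology LatticeOrderedAddCommGroup

universe u v w

namespace BanachLattice

section

variable {E : Type u} [NormedAddCommGroup E] [NormedSpace ℝ E] [Lattice E]

/-- The positive cone `(E')⁺` of the norm dual. -/
def DualNonneg (f : StrongDual ℝ E) : Prop :=
  ∀ x : E, 0 ≤ x → 0 ≤ f x

/-- The order of the norm bidual `E''`: `φ ≤ ψ` when `φ f ≤ ψ f` for all `f ∈ (E')⁺`. -/
def BidualLE (φ ψ : StrongDual ℝ (StrongDual ℝ E)) : Prop :=
  ∀ f : StrongDual ℝ E, DualNonneg f → φ f ≤ ψ f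

/-- The positive cone `(E'')⁺` of the norm bidual. -/
def BidualNonneg (φ : StrongDual ℝ (StrongDual ℝ E)) : Prop :=
  BidualLE 0 φ

/-- The order interval `[-φ, φ]` of the norm bidual. -/
def bidualInterval (φ : StrongDual ℝ (StrongDual ℝ E)) : Set (StrongDual ℝ (StrongDual ℝ E)) :=
  {ψ | BidualLE (-φ) ψ ∧ BidualLE ψ φ}

/-- The set `[-φ, φ] ∩ E`, where `E` is canonically embedded in `E''`. -/
def bInterval (φ : StrongDual ℝ (StrongDual ℝ E)) : Set E :=
  {x | NormedSpace.inclusionInDoubleDual ℝ E x ∈ bidualInterval φ}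

/-- A subset of `E` is b-order bounded when it is order bounded in `E''`. -/
def IsBOrderBounded (A : Set E) : Prop :=
  ∃ φ : StrongDual ℝ (StrongDual ℝ E), BidualNonneg φ ∧ A ⊆ bInterval φ

/-- A subset of `E` is b-semi compact when it is almost order bounded in `E''`: for every `ε > 0`
there is `φ ∈ (E'')⁺` with `A ⊆ [-φ, φ] + ε B_{E''}`. -/
def IsBSemiCompact (A : Set E) : Prop :=
  ∀ ε : ℝ, 0 < ε → ∃ φ : StrongDual ℝ (StrongDual ℝ E), BidualNonneg φ ∧
    ∀ x ∈ A, ∃ ψ ∈ bidualInterval φ, ‖NormedSpace.inclusionInDoubleDual ℝ E x - ψ‖ ≤ ε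

/-- Unbounded absolutely weak (uaw) convergence of a family along a filter: for each `y ≥ 0`,
`|x i - a| ⊓ y` tends weakly to `0`. For a net, the filter is `atTop`. -/
def UawTendsto {ι : Type w} (x : ι → E) (l : Filter ι) (a : E) : Prop :=
  ∀ y : E, 0 ≤ y → ∀ f : StrongDual ℝ E, Tendsto (fun i => f (|x i - a| ⊓ y)) l (𝓝 0)

/-- Some subnet of the net `x` is uaw-convergent to `a`. -/
def HasUawSubnetTendsto {ι : Type u} [Preorder ι] (x : ι → E) (a : E) : Prop :=
  ∃ (κ : Type u) (_ : Preorder κ) (_ : IsDirectedOrder κ) (_ : Nonempty κ) (φ : κ → ι),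
    Tendsto φ atTop atTop ∧ UawTendsto (x ∘ φ) atTop a

/-- A norm bounded set `A` is uaw-compact when every net in `A` has a subnet that is
uaw-convergent to a point of `A`. -/
def IsUawCompact (A : Set E) : Prop :=
  Bornology.IsBounded A ∧
    ∀ (ι : Type u) [Preorder ι] [IsDirectedOrder ι] [Nonempty ι] (x : ι → E),
      (∀ i, x i ∈ A) → ∃ a ∈ A, HasUawSubnetTendsto x a

/-- A norm bounded set `A` is relatively uaw-compact when every net in `A` has a subnet that is
uaw-convergent to a point of `E`. -/
def IsRelUawCompact (A : Set E) : Prop :=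
  Bornology.IsBounded A ∧
    ∀ (ι : Type u) [Preorder ι] [IsDirectedOrder ι] [Nonempty ι] (x : ι → E),
      (∀ i, x i ∈ A) → ∃ a : E, HasUawSubnetTendsto x a

/-- `T` is `S`-L-weakly compact: `S` is norm bounded and `T` maps each uaw-null sequence of the
solid hull of `S` to a norm null sequence. -/
def IsLwcOn {Y : Type v} [NormedAddCommGroup Y] [NormedSpace ℝ Y] (S : Set E) (T : E →L[ℝ] Y) :
    Prop :=
  Bornology.IsBounded S ∧
    ∀ x : ℕ → E, (∀ n, x n ∈ solidClosure S) → UawTendsto x atTop 0 →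
      Tendsto (fun n => T (x n)) atTop (𝓝 0)

end

section

variable {E : Type u} [NormedAddCommGroup E] [Lattice E]

/-- A norm bounded set `A` is L-weakly compact when each disjoint sequence of its solid hull is
norm null. -/
def IsLWeaklyCompact (A : Set E) : Prop :=
  Bornology.IsBounded A ∧
    ∀ x : ℕ → E, (∀ n, x n ∈ solidClosure A) → (Pairwise fun m n => |x m| ⊓ |x n| = 0) →
      Tendsto x atTop (𝓝 0)

/-- `E` is a KB-space: each norm bounded increasing sequence of `E⁺` is norm convergent. -/
def IsKBSpace (E : Type u) [NormedAddCommGroup E] [Lattice E] : Prop :=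
  ∀ x : ℕ → E, Monotone x → (∀ n, 0 ≤ x n) → (∃ C : ℝ, ∀ n, ‖x n‖ ≤ C) →
    ∃ a : E, Tendsto x atTop (𝓝 a)

end

end BanachLattice

/-!
In a KB-space, a norm bounded set closed under suprema is order bounded, so `[-v, v] ∩ E` lies in an
order interval `[-w, w]` with `w ∈ E⁺`. Since the norm is order continuous, some `g ∈ (E')⁺` gives
`‖x‖ ≤ g |x| + ε` for `|x| ≤ w`, and this estimate makes every uaw-null net of `[-v, v] ∩ E` norm
null. Conversely, a norm bounded increasing sequence of `E⁺` has a weak-* cluster point `v` above it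
in `E''`; the increments of each of its subsequences lie in `[-v, v]` and are uaw-null, because
every functional has summable values on their truncations, so the sequence is Cauchy if uaw-null
sequences of `[-v, v] ∩ E` are norm null.

For a b-semi compact set, an `x ∈ E⁺` below `v + ε B_{E''}` is within `ε` of an element of `[0, x]`
below `v`: by Hahn–Banach and the Riesz–Kantorovich formula finitely many of the inequalities this
requires can be solved at once, and the order interval `[0, x]` is weakly compact. So a disjoint
sequence of the solid hull is within `ε` of a disjoint sequence of `[0, w]`, which is norm null.
-/

namespace BanachLattice

section LatticeGroup

variable {E : Type u} [AddCommGroup E] [Lattice E] [IsOrderedAddMonoid E]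

theorem inf_add_le_inf_add_inf {a b c : E} (ha : 0 ≤ a) (hb : 0 ≤ b) (hc : 0 ≤ c) :
    a ⊓ (b + c) ≤ a ⊓ b + a ⊓ c := by
  rw [inf_add, add_inf, add_inf]
  exact le_inf (le_inf (inf_le_left.trans (le_add_of_nonneg_left ha))
    (inf_le_left.trans (le_add_of_nonneg_right hc)))
    (le_inf (inf_le_left.trans (le_add_of_nonneg_left hb)) inf_le_right)

theorem posPart_add_le (a b : E) : (a + b)⁺ ≤ a⁺ + b⁺ :=
  sup_le (add_le_add (le_posPart a) (le_posPart b))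
    (add_nonneg (posPart_nonneg a) (posPart_nonneg b))

theorem sub_inf_eq_posPart_sub (a b : E) : a - a ⊓ b = (a - b)⁺ := by
  rw [inf_eq_sub_posPart_sub, sub_sub_cancel]

theorem posPart_inf_posPart_neg (a : E) : a⁺ ⊓ (-a)⁺ = 0 := by
  rw [posPart_neg, posPart_inf_negPart_eq_zero]

theorem posPart_inf_posPart_neg_add_le (a b : E) : a⁺ ⊓ (-b)⁺ + (a + b)⁺ ≤ a⁺ + b⁺ := by
  have hb : a⁺ ⊓ (-b)⁺ + b ≤ b⁺ := by
    calc a⁺ ⊓ (-b)⁺ + b ≤ (-b)⁺ + b := by gcongr; exact inf_le_right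
      _ = b⁺ := by rw [posPart_neg, add_comm, ← eq_sub_iff_add_eq, posPart_sub_negPart]
  rw [posPart_def (a + b), add_sup, add_zero]
  refine sup_le ?_ (inf_le_left.trans (le_add_of_nonneg_right (posPart_nonneg b)))
  calc a⁺ ⊓ (-b)⁺ + (a + b) = a + (a⁺ ⊓ (-b)⁺ + b) := by abel
    _ ≤ a⁺ + b⁺ := add_le_add (le_posPart a) hb

/-- Going from `z` up to `y` in steps of `d`, each level `t k` that is passed contributes its
overlap with both ends. -/
theorem sub_le_add_sum_posPart_inf_posPart {y z d : E} {t : ℕ → E} {N : ℕ} (h₀ : t 0 ≤ z)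
    (hN : y ≤ t N) (ht : ∀ k, t (k + 1) ≤ t k + d) (hd : 0 ≤ d) :
    y - z ≤ d + ∑ k ∈ Finset.range N, (y - t k)⁺ ⊓ (t k - z)⁺ := by
  have climb : ∀ n, y ⊓ t n - z ≤ d + ∑ k ∈ Finset.range n, (y - t k)⁺ ⊓ (t k - z)⁺ := by
    intro n
    induction n with
    | zero =>
      rw [Finset.sum_range_zero, add_zero]
      exact (sub_nonpos.2 (inf_le_right.trans h₀)).trans hd
    | succ n ih =>
      rw [Finset.sum_range_succ, ← add_assoc, add_inf]
      refine le_inf ?_ ?_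
      · calc y ⊓ t (n + 1) - z ≤ y - z := by gcongr; exact inf_le_left
          _ = y ⊓ t n - z + (y - t n)⁺ := by rw [← sub_inf_eq_posPart_sub]; abel
          _ ≤ _ := by gcongr
      · have hsum : 0 ≤ ∑ k ∈ Finset.range n, (y - t k)⁺ ⊓ (t k - z)⁺ :=
          Finset.sum_nonneg fun k _ => le_inf (posPart_nonneg _) (posPart_nonneg _)
        calc y ⊓ t (n + 1) - z ≤ t n + d - z := by gcongr; exact inf_le_right.trans (ht n)
          _ = d + 0 + (t n - z) := by abel
          _ ≤ _ := by gcongr; exact le_posPart _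
  calc y - z = y ⊓ t N - z := by rw [inf_eq_left.2 hN]
    _ ≤ _ := climb N

end LatticeGroup

section OrderedModule

variable {E : Type u} [AddCommGroup E] [Module ℝ E] [Lattice E] [IsOrderedModule ℝ E]

theorem posPart_smul {c : ℝ} (hc : 0 < c) (x : E) : (c • x)⁺ = c • x⁺ := by
  have h := (OrderIso.smulRight hc : E ≃o E).map_sup x 0
  exact (h.trans (congrArg _ (smul_zero c))).symm

end OrderedModule

section HahnBanach

variable {E : Type u} [AddCommGroup E] [Module ℝ E]

theorem exists_linear_le_sublinear {p : E → ℝ} (hp : ∀ c : ℝ, 0 < c → ∀ x, p (c • x) = c * p x)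
    (ha : ∀ x y, p (x + y) ≤ p x + p y) (x₀ : E) :
    ∃ g : E →ₗ[ℝ] ℝ, g x₀ = p x₀ ∧ ∀ x, g x ≤ p x := by
  have p0 : p 0 = 0 := by
    have := hp 2 two_pos 0
    rw [smul_zero] at this; linarith
  have hspan : ∀ c : ℝ, c • x₀ = 0 → c • p x₀ = 0 := fun c hc => by
    rcases smul_eq_zero.1 hc with rfl | rfl
    · exact zero_smul ℝ _
    · rw [p0, smul_zero]
  obtain ⟨g, hg, hgp⟩ := exists_extension_of_le_sublinear
    (LinearPMap.mkSpanSingleton' x₀ (p x₀) hspan) p hp ha (by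
      rintro ⟨x, hx⟩
      obtain ⟨t, rfl⟩ := Submodule.mem_span_singleton.1 hx
      refine (LinearPMap.mkSpanSingleton'_apply x₀ (p x₀) hspan t hx).trans_le ?_
      simp only [smul_eq_mul, RingHom.id_apply]
      rcases lt_trichotomy t 0 with ht | rfl | ht
      · have h := ha (t • x₀) ((-t) • x₀)
        rw [← add_smul, add_neg_cancel, zero_smul, p0, hp (-t) (neg_pos.2 ht)] at h
        linarith
      · rw [zero_mul, zero_smul, p0]
      · exact (hp t ht x₀).ge)
  refine ⟨g, (hg ⟨x₀, Submodule.mem_span_singleton_self x₀⟩).trans ?_, hgp⟩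
  exact LinearPMap.mkSpanSingleton'_apply_self x₀ (p x₀) hspan _

end HahnBanach

section SolidNorm

variable {E : Type u} [NormedAddCommGroup E] [Lattice E] [HasSolidNorm E]

theorem isBounded_solidClosure {A : Set E} (hA : Bornology.IsBounded A) :
    Bornology.IsBounded (solidClosure A) := by
  obtain ⟨C, hC⟩ := isBounded_iff_forall_norm_le.1 hA
  refine isBounded_iff_forall_norm_le.2 ⟨C, ?_⟩
  rintro x ⟨y, hy, hxy⟩
  exact (norm_le_norm_of_abs_le_abs hxy).trans (hC y hy)

variable [IsOrderedAddMonoid E]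

theorem norm_le_norm_of_nonneg {x y : E} (hx : 0 ≤ x) (h : x ≤ y) : ‖x‖ ≤ ‖y‖ :=
  norm_le_norm_of_abs_le_abs (by rwa [abs_of_nonneg hx, abs_of_nonneg (hx.trans h)])

theorem norm_posPart_le (x : E) : ‖x⁺‖ ≤ ‖x‖ := by
  rw [← norm_abs_eq_norm x]
  exact norm_le_norm_of_nonneg (posPart_nonneg x) (sup_le (le_abs_self x) (abs_nonneg x))

end SolidNorm

section Dual

variable {E : Type u} [NormedAddCommGroup E] [NormedSpace ℝ E] [Lattice E]

theorem DualNonneg.zero : DualNonneg (0 : StrongDual ℝ E) := fun _ _ => le_rfl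

theorem DualNonneg.add {f g : StrongDual ℝ E} (hf : DualNonneg f) (hg : DualNonneg g) :
    DualNonneg (f + g) := fun x hx => add_nonneg (hf x hx) (hg x hx)

theorem DualNonneg.smul {f : StrongDual ℝ E} (hf : DualNonneg f) {c : ℝ} (hc : 0 ≤ c) :
    DualNonneg (c • f) := fun x hx => mul_nonneg hc (hf x hx)

theorem DualNonneg.sum {ι : Type*} {s : Finset ι} {f : ι → StrongDual ℝ E}
    (hf : ∀ i ∈ s, DualNonneg (f i)) : DualNonneg (∑ i ∈ s, f i) :=
  Finset.sum_induction f DualNonneg (fun _ _ => DualNonneg.add) DualNonneg.zero hf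

theorem dualNonneg_sub_iff {f g : StrongDual ℝ E} :
    DualNonneg (f - g) ↔ ∀ x, 0 ≤ x → g x ≤ f x :=
  forall₂_congr fun _ _ => sub_nonneg

variable [IsOrderedAddMonoid E]

theorem DualNonneg.monotone {f : StrongDual ℝ E} (hf : DualNonneg f) : Monotone f := fun x y h => by
  rw [← sub_nonneg, ← map_sub]
  exact hf (y - x) (sub_nonneg.2 h)

theorem DualNonneg.abs_apply_le {f : StrongDual ℝ E} (hf : DualNonneg f) (x : E) :
    |f x| ≤ f |x| := by
  rw [abs_le', ← map_neg]
  exact ⟨hf.monotone (le_abs_self x), hf.monotone (neg_le_abs x)⟩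

variable [HasSolidNorm E]

theorem norm_le_of_dualNonneg_sub {f g : StrongDual ℝ E} (hg : DualNonneg g)
    (hfg : DualNonneg (f - g)) : ‖g‖ ≤ ‖f‖ := by
  refine ContinuousLinearMap.opNorm_le_bound _ (norm_nonneg _) fun x => ?_
  calc ‖g x‖ ≤ g |x| := hg.abs_apply_le x
    _ ≤ f |x| := dualNonneg_sub_iff.1 hfg _ (abs_nonneg x)
    _ ≤ ‖f‖ * ‖|x|‖ := (le_abs_self _).trans (f.le_opNorm _)
    _ = ‖f‖ * ‖x‖ := by rw [norm_abs_eq_norm]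

theorem exists_dualNonneg_le_sublinear {p : E → ℝ} (hp : ∀ c : ℝ, 0 < c → ∀ x, p (c • x) = c * p x)
    (ha : ∀ x y, p (x + y) ≤ p x + p y) {C : ℝ} (hC₀ : 0 ≤ C) (hC : ∀ x, p x ≤ C * ‖x⁺‖) (x₀ : E) :
    ∃ g : StrongDual ℝ E, DualNonneg g ∧ ‖g‖ ≤ C ∧ g x₀ = p x₀ ∧ ∀ x, g x ≤ p x := by
  obtain ⟨g, hg₀, hgp⟩ := exists_linear_le_sublinear hp ha x₀
  have hgC : ∀ x, g x ≤ C * ‖x⁺‖ := fun x => (hgp x).trans (hC x)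
  have hbound : ∀ x, ‖g x‖ ≤ C * ‖x‖ := fun x => by
    rw [Real.norm_eq_abs, abs_le', ← map_neg]
    refine ⟨(hgC x).trans (by gcongr; exact norm_posPart_le x), (hgC (-x)).trans ?_⟩
    rw [← norm_neg x]
    gcongr
    exact norm_posPart_le (-x)
  refine ⟨g.mkContinuous C hbound, fun x hx => ?_, g.mkContinuous_norm_le hC₀ hbound, hg₀, hgp⟩
  have h := hgC (-x)
  rw [posPart_eq_zero.2 (neg_nonpos.2 hx), norm_zero, mul_zero, map_neg] at h
  exact neg_nonpos.1 h

variable [IsOrderedModule ℝ E]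

theorem exists_dualNonneg_apply_eq_norm {x : E} (hx : 0 ≤ x) :
    ∃ g : StrongDual ℝ E, DualNonneg g ∧ ‖g‖ ≤ 1 ∧ g x = ‖x‖ := by
  obtain ⟨g, hg, hg₁, hgx, -⟩ := exists_dualNonneg_le_sublinear (p := fun y : E => ‖y⁺‖)
    (fun c hc y => by rw [posPart_smul hc, norm_smul, Real.norm_of_nonneg hc.le])
    (fun y z => (norm_le_norm_of_nonneg (posPart_nonneg _) (posPart_add_le y z)).trans
      (norm_add_le _ _)) zero_le_one (fun y => by rw [one_mul]) x
  exact ⟨g, hg, hg₁, by rw [hgx, posPart_of_nonneg hx]⟩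

theorem norm_le_of_dualNonneg {x : E} (hx : 0 ≤ x) {C : ℝ}
    (h : ∀ f : StrongDual ℝ E, DualNonneg f → ‖f‖ ≤ 1 → f x ≤ C) : ‖x‖ ≤ C := by
  obtain ⟨g, hg, hg₁, hgx⟩ := exists_dualNonneg_apply_eq_norm hx
  exact hgx ▸ h g hg hg₁

theorem DualNonneg.exists_split {f : StrongDual ℝ E} (hf : DualNonneg f) (x : E) :
    ∃ g : StrongDual ℝ E, DualNonneg g ∧ DualNonneg (f - g) ∧ g x = f x⁺ := by
  obtain ⟨g, hg, -, hgx, hgf⟩ := exists_dualNonneg_le_sublinear (p := fun y : E => f y⁺)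
    (fun c hc y => by rw [posPart_smul hc, map_smul, smul_eq_mul])
    (fun y z => by rw [← map_add]; exact hf.monotone (posPart_add_le y z)) (norm_nonneg f)
    (fun y => (le_abs_self _).trans (f.le_opNorm _)) x
  refine ⟨g, hg, dualNonneg_sub_iff.2 fun y hy => ?_, hgx⟩
  exact (hgf y).trans_eq (by rw [posPart_of_nonneg hy])

/-- The Riesz–Kantorovich formula `(f ⊓ h) x = inf {f y + h (x - y) | 0 ≤ y ≤ x}`: the infimum is
attained by a positive functional below `f` and `h`. -/
theorem DualNonneg.exists_inf {f h : StrongDual ℝ E} (hf : DualNonneg f) (hh : DualNonneg h)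
    {x : E} {r : ℝ} (hr : ∀ y, 0 ≤ y → y ≤ x → r ≤ f y + h (x - y)) (hx : 0 ≤ x) :
    ∃ k : StrongDual ℝ E, DualNonneg k ∧ DualNonneg (f - k) ∧ DualNonneg (h - k) ∧ r ≤ k x := by
  let q : E → {a : E // 0 ≤ a} → ℝ := fun v a => f a + h (v - a)⁺
  have hq₀ : ∀ v a, 0 ≤ q v a := fun v a => add_nonneg (hf _ a.2) (hh _ (posPart_nonneg _))
  have hbdd : ∀ v, BddBelow (Set.range (q v)) := fun v => ⟨0, Set.forall_mem_range.2 (hq₀ v)⟩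
  have hpf : ∀ v, ⨅ a, q v a ≤ f v⁺ := fun v => by
    refine (ciInf_le (hbdd v) ⟨v⁺, posPart_nonneg v⟩).trans_eq ?_
    simp only [q, posPart_eq_zero.2 (sub_nonpos.2 (le_posPart v)), map_zero, add_zero]
  have hph : ∀ v, ⨅ a, q v a ≤ h v⁺ := fun v => by
    refine (ciInf_le (hbdd v) ⟨0, le_rfl⟩).trans_eq ?_
    simp only [q, map_zero, zero_add, sub_zero]
  have hsmul : ∀ c : ℝ, 0 < c → ∀ v, ⨅ a, q (c • v) a = c * ⨅ a, q v a := fun c hc v => by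
    let e : {a : E // 0 ≤ a} ≃ {a : E // 0 ≤ a} :=
      (OrderIso.smulRight hc).toEquiv.subtypeEquiv fun a =>
        (smul_nonneg_iff_nonneg_of_pos_left hc).symm
    rw [Real.mul_iInf_of_nonneg hc.le]
    refine (e.iInf_congr fun a => ?_).symm
    change f (c • a) + h (c • v - c • a)⁺ = c * (f a + h (v - a)⁺)
    rw [← smul_sub, posPart_smul hc, map_smul, map_smul, smul_eq_mul, smul_eq_mul, mul_add]
  have hadd : ∀ v w, ⨅ a, q (v + w) a ≤ (⨅ a, q v a) + ⨅ a, q w a := fun v w => by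
    refine le_ciInf_add_ciInf fun a b => (ciInf_le (hbdd _) ⟨a + b, add_nonneg a.2 b.2⟩).trans ?_
    have hvw := hh.monotone (posPart_add_le (v - a) (w - b))
    rw [← add_sub_add_comm, map_add] at hvw
    simp only [q, map_add]
    linarith
  obtain ⟨k, hk, -, hkx, hkq⟩ := exists_dualNonneg_le_sublinear hsmul hadd (norm_nonneg f)
    (fun v => (hpf v).trans ((le_abs_self _).trans (f.le_opNorm _))) x
  refine ⟨k, hk, dualNonneg_sub_iff.2 fun v hv => ?_, dualNonneg_sub_iff.2 fun v hv => ?_,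
    hkx ▸ ?_⟩
  · exact ((hkq v).trans (hpf v)).trans_eq (by rw [posPart_of_nonneg hv])
  · exact ((hkq v).trans (hph v)).trans_eq (by rw [posPart_of_nonneg hv])
  · refine le_ciInf fun a => (hr (x ⊓ a) (le_inf hx a.2) inf_le_left).trans ?_
    rw [sub_inf_eq_posPart_sub]
    exact add_le_add_left (hf.monotone inf_le_right) _

end Dual

section DominatedBy

variable {E : Type u} [NormedAddCommGroup E] [NormedSpace ℝ E] [Lattice E]
  {φ : StrongDual ℝ (StrongDual ℝ E)}

/-- `x` lies below `φ` in the bidual up to an error of norm `c`, tested on positive functionals; for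
`c = 0` this is the order of the bidual. -/
def DominatedBy (φ : StrongDual ℝ (StrongDual ℝ E)) (c : ℝ) (x : E) : Prop :=
  ∀ f : StrongDual ℝ E, DualNonneg f → f x ≤ φ f + c * ‖f‖

theorem dominatedBy_zero_iff {x : E} :
    DominatedBy φ 0 x ↔ ∀ f : StrongDual ℝ E, DualNonneg f → f x ≤ φ f := by
  simp only [DominatedBy, zero_mul, add_zero]

theorem BidualNonneg.dominatedBy_zero (hφ : BidualNonneg φ) : DominatedBy φ 0 (0 : E) :=
  dominatedBy_zero_iff.2 fun f hf => (map_zero f).trans_le (hφ f hf)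

theorem mem_bInterval_iff {x : E} : x ∈ bInterval φ ↔ DominatedBy φ 0 x ∧ DominatedBy φ 0 (-x) := by
  simp only [dominatedBy_zero_iff, map_neg]
  refine and_comm.trans (and_congr_right' (forall₂_congr fun f _ => ?_))
  rw [NormedSpace.dual_def, _root_.neg_apply, neg_le]

theorem bidualNonneg_inclusion {x : E} (hx : 0 ≤ x) :
    BidualNonneg (NormedSpace.inclusionInDoubleDual ℝ E x) := fun _ hf => hf x hx

theorem isBSemiCompact_bInterval (hφ : BidualNonneg φ) : IsBSemiCompact (bInterval φ : Set E) :=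
  fun ε hε => ⟨φ, hφ, fun x hx => ⟨NormedSpace.inclusionInDoubleDual ℝ E x, hx, by
    simpa only [sub_self, ContinuousLinearMap.opNorm_zero] using hε.le⟩⟩

variable [IsOrderedAddMonoid E]

theorem DominatedBy.of_le {c : ℝ} {x y : E} (hy : DominatedBy φ c y) (h : x ≤ y) :
    DominatedBy φ c x := fun f hf => (hf.monotone h).trans (hy f hf)

theorem mem_bInterval_inclusion {w x : E} (h : |x| ≤ w) :
    x ∈ bInterval (NormedSpace.inclusionInDoubleDual ℝ E w) :=
  mem_bInterval_iff.2 ⟨dominatedBy_zero_iff.2 fun _ hf => hf.monotone ((le_abs_self x).trans h),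
    dominatedBy_zero_iff.2 fun _ hf => hf.monotone ((neg_le_abs x).trans h)⟩

variable [HasSolidNorm E] [IsOrderedModule ℝ E]

theorem DominatedBy.sup {c d : ℝ} (hc : 0 ≤ c) (hd : 0 ≤ d) {x y : E} (hx : DominatedBy φ c x)
    (hy : DominatedBy φ d y) : DominatedBy φ (c + d) (x ⊔ y) := by
  intro f hf
  obtain ⟨g, hg, hfg, hgx⟩ := hf.exists_split (x - y)
  have hg_norm : ‖g‖ ≤ ‖f‖ := norm_le_of_dualNonneg_sub hg hfg
  have hfg_norm : ‖f - g‖ ≤ ‖f‖ := norm_le_of_dualNonneg_sub hfg (by rwa [sub_sub_cancel])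
  calc f (x ⊔ y) = g x + (f - g) y := by
        rw [sup_eq_add_posPart_sub, map_add, ← hgx, map_sub, _root_.sub_apply]; ring
    _ ≤ (φ g + c * ‖f‖) + (φ (f - g) + d * ‖f‖) := by
        gcongr
        · exact (hx g hg).trans (by gcongr)
        · exact (hy (f - g) hfg).trans (by gcongr)
    _ = φ f + (c + d) * ‖f‖ := by rw [map_sub]; ring

theorem DominatedBy.sup_zero {x y : E} (hx : DominatedBy φ 0 x) (hy : DominatedBy φ 0 y) :
    DominatedBy φ 0 (x ⊔ y) := by
  simpa only [add_zero] using hx.sup le_rfl le_rfl hy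

theorem DominatedBy.norm_le {c : ℝ} (hc : 0 ≤ c) {x : E} (hx : DominatedBy φ c x) (h₀ : 0 ≤ x) :
    ‖x‖ ≤ ‖φ‖ + c := by
  refine norm_le_of_dualNonneg h₀ fun f hf hf₁ => (hx f hf).trans ?_
  gcongr
  · exact (le_abs_self _).trans (φ.le_of_opNorm_le_of_le le_rfl hf₁ |>.trans_eq (mul_one _))
  · exact mul_le_of_le_one_right hc hf₁

theorem mem_bInterval_iff_abs {x : E} : x ∈ bInterval φ ↔ DominatedBy φ 0 |x| :=
  mem_bInterval_iff.trans
    ⟨fun h => h.1.sup_zero h.2, fun h => ⟨h.of_le (le_abs_self x), h.of_le (neg_le_abs x)⟩⟩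

theorem solidClosure_bInterval_subset : solidClosure (bInterval φ : Set E) ⊆ bInterval φ := by
  rintro x ⟨y, hy, hxy⟩
  exact mem_bInterval_iff_abs.2 ((mem_bInterval_iff_abs.1 hy).of_le hxy)

theorem isBounded_bInterval : Bornology.IsBounded (bInterval φ : Set E) := by
  refine isBounded_iff_forall_norm_le.2 ⟨‖φ‖ + 0, fun x hx => ?_⟩
  rw [← norm_abs_eq_norm]
  exact (mem_bInterval_iff_abs.1 hx).norm_le le_rfl (abs_nonneg x)

end DominatedBy

section BanachAlaoglu

variable {E : Type u} [NormedAddCommGroup E] [NormedSpace ℝ E] [Lattice E] [IsOrderedAddMonoid E]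

/-- A weak-* cluster point of the sequence in the bidual dominates it. -/
theorem exists_bidual_dominating {x : ℕ → E} (hx : Monotone x) (h₀ : ∀ n, 0 ≤ x n) {C : ℝ}
    (hC : ∀ n, ‖x n‖ ≤ C) :
    ∃ φ : StrongDual ℝ (StrongDual ℝ E), BidualNonneg φ ∧ ∀ n, DominatedBy φ 0 (x n) := by
  let J : ℕ → WeakDual ℝ (StrongDual ℝ E) :=
    fun n => StrongDual.toWeakDual (NormedSpace.inclusionInDoubleDual ℝ E (x n))
  have hJC : ∀ n, J n ∈ WeakDual.toStrongDual ⁻¹' Metric.closedBall 0 C := fun n =>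
    (mem_closedBall_zero_iff (E := StrongDual ℝ (StrongDual ℝ E))).2
      ((NormedSpace.double_dual_bound ℝ E (x n)).trans (hC n))
  obtain ⟨φ, -, hφ : Tendsto J (hyperfilter ℕ) (𝓝 φ)⟩ :=
    (WeakDual.isCompact_closedBall (𝕜 := ℝ) (E := StrongDual ℝ E) 0 C).ultrafilter_le_nhds
      ((hyperfilter ℕ).map J) (le_principal_iff.2 (Ultrafilter.mem_map.2 (univ_mem' hJC)))
  have hxφ : ∀ f : StrongDual ℝ E, DualNonneg f → ∀ n, f (x n) ≤ φ f := by
    intro f hf n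
    have hlim : Tendsto (fun m => f (x m)) (hyperfilter ℕ) (𝓝 (φ f)) :=
      ((WeakDual.eval_continuous f).tendsto φ).comp hφ
    exact ge_of_tendsto hlim (Nat.hyperfilter_le_atTop
      ((eventually_ge_atTop n).mono fun m hm => hf.monotone (hx hm)))
  exact ⟨WeakDual.toStrongDual φ, fun f hf => (hf _ (h₀ 0)).trans (hxφ f hf 0),
    fun n => dominatedBy_zero_iff.2 fun f hf => hxφ f hf n⟩

end BanachAlaoglu

section KBSpace

variable {E : Type u} [NormedAddCommGroup E] [Lattice E]

theorem exists_forall_norm_sub_le_two_mul {A : Set E} (hA : Bornology.IsBounded A) (x : A) :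
    ∃ x' : A, x ≤ x' ∧ ∀ y : A, x ≤ y → ‖(y : E) - x‖ ≤ 2 * ‖(x' : E) - x‖ := by
  obtain ⟨C, hC⟩ := isBounded_iff_forall_norm_le.1 hA
  let r : {y : A // x ≤ y} → ℝ := fun y => ‖(y : E) - x‖
  have hr : BddAbove (Set.range r) := ⟨C + C, Set.forall_mem_range.2 fun y =>
    (norm_sub_le _ _).trans (add_le_add (hC _ y.1.2) (hC _ x.2))⟩
  have : Nonempty {y : A // x ≤ y} := ⟨⟨x, le_rfl⟩⟩
  rcases le_or_gt (⨆ y, r y) 0 with h₀ | h₀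
  · refine ⟨x, le_rfl, fun y hy => ?_⟩
    rw [sub_self, norm_zero, mul_zero]
    exact (le_ciSup hr ⟨y, hy⟩).trans h₀
  · obtain ⟨x', hx'⟩ := exists_lt_of_lt_ciSup (half_lt_self h₀)
    exact ⟨x'.1, x'.2, fun y hy => (le_ciSup hr ⟨y, hy⟩).trans ((div_le_iff₀' two_pos).1 hx'.le)⟩

variable [IsOrderedAddMonoid E] [HasSolidNorm E]

theorem IsKBSpace.bddAbove (h : IsKBSpace E) {A : Set E} (hA : SupClosed A)
    (hA₀ : ∀ x ∈ A, 0 ≤ x) (hA_bdd : Bornology.IsBounded A) : BddAbove A := by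
  rcases A.eq_empty_or_nonempty with rfl | ⟨x₀, hx₀⟩
  · exact bddAbove_empty
  choose s hxs hs using exists_forall_norm_sub_le_two_mul hA_bdd
  let x : ℕ → A := fun n => s^[n] ⟨x₀, hx₀⟩
  have hx_succ : ∀ n, x (n + 1) = s (x n) := fun n => Function.iterate_succ_apply' s n _
  obtain ⟨C, hC⟩ := isBounded_iff_forall_norm_le.1 hA_bdd
  obtain ⟨a, ha⟩ := h (fun n => (x n : E))
    (monotone_nat_of_le_succ fun n => hx_succ n ▸ hxs (x n)) (fun n => hA₀ _ (x n).2)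
    ⟨C, fun n => hC _ (x n).2⟩
  have hgap : Tendsto (fun n => 2 * ‖(x (n + 1) : E) - x n‖) atTop (𝓝 0) := by
    simpa only [sub_self, norm_zero, mul_zero, Function.comp_apply] using
      (((ha.comp (tendsto_add_atTop_nat 1)).sub ha).norm).const_mul 2
  refine ⟨a, fun y hy => ?_⟩
  have hlim : Tendsto (fun n => (y - (x n : E))⁺) atTop (𝓝 ((y - a)⁺)) :=
    (continuous_posPart.tendsto _).comp (tendsto_const_nhds.sub ha)
  have hzero : Tendsto (fun n => (y - (x n : E))⁺) atTop (𝓝 0) := by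
    refine squeeze_zero_norm (fun n => ?_) hgap
    have hsup := hs (x n) ⟨y ⊔ x n, hA hy (x n).2⟩ le_sup_right
    simpa only [sup_eq_add_posPart_sub, add_sub_cancel_left, hx_succ, add_comm] using hsup
  exact sub_nonpos.1 (posPart_eq_zero.1 (tendsto_nhds_unique hlim hzero))

end KBSpace

section Sequences

theorem exists_seq_of_forall_nat_finset_exists {α : Type*} (P : α → Prop) (r : ℕ → α → α → Prop)
    (hr : ∀ a b, P a → P b → ∀ m n, m ≤ n → r n a b → r m a b)
    (h : ∀ (n : ℕ) (s : Finset α), (∀ a ∈ s, P a) → ∃ b, P b ∧ ∀ a ∈ s, r n a b) :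
    ∃ f : ℕ → α, (∀ n, P (f n)) ∧ ∀ m n, m < n → r n (f m) (f n) := by
  classical
  obtain ⟨f, hfP, hf⟩ := exists_seq_of_forall_finset_exists (fun a : ℕ × α => P a.2)
    (fun a b => a.1 < b.1 ∧ r b.1 a.2 b.2) fun s hs => by
      obtain ⟨b, hbP, hb⟩ := h (s.sup Prod.fst + 1) (s.image Prod.snd)
        (Finset.forall_mem_image.2 hs)
      exact ⟨(s.sup Prod.fst + 1, b), hbP, fun a ha =>
        ⟨Nat.lt_succ_of_le (Finset.le_sup (f := Prod.fst) ha), hb _ (Finset.mem_image_of_mem _ ha)⟩⟩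
  have hmono : StrictMono fun n => (f n).1 := fun m n hmn => (hf m n hmn).1
  exact ⟨fun n => (f n).2, hfP, fun m n hmn =>
    hr _ _ (hfP m) (hfP n) _ _ (hmono.id_le n) (hf m n hmn).2⟩

theorem cauchySeq_of_tendsto_dist_subseq {X : Type*} [PseudoMetricSpace X] {x : ℕ → X}
    (h : ∀ σ : ℕ → ℕ, StrictMono σ →
      Tendsto (fun k => dist (x (σ (k + 1))) (x (σ k))) atTop (𝓝 0)) : CauchySeq x := by
  rw [Metric.cauchySeq_iff']
  by_contra! ⟨ε, hε, hx⟩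
  choose s hs hxs using hx
  have hs_lt : ∀ n, n < s n := fun n => (hs n).lt_of_ne fun hn => by
    have := hxs n
    rw [← hn, dist_self] at this
    exact absurd hε this.not_gt
  have hσ : StrictMono fun k => s^[k] 0 := strictMono_nat_of_lt_succ fun k => by
    rw [Function.iterate_succ_apply']; exact hs_lt _
  obtain ⟨k, hk⟩ := ((h _ hσ).eventually (gt_mem_nhds hε)).exists
  rw [Function.iterate_succ_apply'] at hk
  exact absurd hk (hxs _).not_gt

end Sequences

section SummableValues

variable {E : Type u} [NormedAddCommGroup E] [NormedSpace ℝ E] [Lattice E]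

theorem exists_seq_summable_apply {A : Set E} {G : E → StrongDual ℝ E} {C : ℝ}
    (hA : ∀ x ∈ A, 0 ≤ x) (hG : ∀ x ∈ A, DualNonneg (G x))
    (h : ∀ g : StrongDual ℝ E, DualNonneg g → ∃ x ∈ A, g x ≤ C) :
    ∃ x : ℕ → E, (∀ n, x n ∈ A) ∧ ∀ m, Summable fun n => G (x m) (x n) := by
  obtain ⟨x, hxA, hx⟩ := exists_seq_of_forall_nat_finset_exists (· ∈ A)
    (fun n x y => 2 ^ n * G x y ≤ C)
    (fun x y hx hy m n hmn hxy => le_trans (by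
      gcongr
      · exact hG x hx y (hA y hy)
      · exact one_le_two) hxy) fun n s hs => by
    obtain ⟨y, hyA, hy⟩ := h ((2 : ℝ) ^ n • ∑ x ∈ s, G x)
      ((DualNonneg.sum fun x hx => hG x (hs x hx)).smul (by positivity))
    refine ⟨y, hyA, fun x hx => le_trans ?_ hy⟩
    rw [_root_.smul_apply, _root_.sum_apply, smul_eq_mul]
    gcongr
    exact Finset.single_le_sum (f := fun z => G z y) (fun z hz => hG z (hs z hz) y (hA y hyA)) hx
  refine ⟨x, hxA, fun m =>
    Summable.of_norm_bounded_eventually_nat (summable_geometric_two.mul_right C) ?_⟩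
  filter_upwards [eventually_gt_atTop m] with n hmn
  rw [Real.norm_of_nonneg (hG _ (hxA m) _ (hA _ (hxA n))), one_div, inv_pow]
  exact (le_inv_mul_iff₀ (by positivity)).2 (hx m n hmn)

end SummableValues

section OrderContinuity

variable {E : Type u} [NormedAddCommGroup E] [Lattice E]

/-- Every increasing sequence of the order interval `[0, w]` is norm convergent: order continuity of
the norm, localized below `w`. -/
def MonotoneConvergesBelow (w : E) : Prop :=
  ∀ x : ℕ → E, Monotone x → (∀ n, 0 ≤ x n) → (∀ n, x n ≤ w) → ∃ a, Tendsto x atTop (𝓝 a)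

variable [IsOrderedAddMonoid E]

theorem MonotoneConvergesBelow.exists_tendsto_of_antitone {w : E} (hw : MonotoneConvergesBelow w)
    {x : ℕ → E} (hx : Antitone x) (h₀ : ∀ n, 0 ≤ x n) (hxw : ∀ n, x n ≤ w) :
    ∃ a, Tendsto x atTop (𝓝 a) := by
  obtain ⟨a, ha⟩ := hw (fun n => w - x n) (fun _ _ h => sub_le_sub_left (hx h) w)
    (fun n => sub_nonneg.2 (hxw n)) (fun n => sub_le_self w (h₀ n))
  exact ⟨w - a, by simpa only [sub_sub_cancel] using (tendsto_const_nhds (x := w)).sub ha⟩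

variable [HasSolidNorm E]

theorem IsKBSpace.monotoneConvergesBelow (h : IsKBSpace E) (w : E) : MonotoneConvergesBelow w :=
  fun x hx h₀ hw => h x hx h₀ ⟨‖w‖, fun n => norm_le_norm_of_nonneg (h₀ n) (hw n)⟩

variable [NormedSpace ℝ E]

/-- The sequence `z n` is the supremum of `x k` over `k ≥ n`, and `c` is the upper limit of `x`. -/
theorem MonotoneConvergesBelow.exists_limsup {w : E} (hw : MonotoneConvergesBelow w) {x : ℕ → E}
    (h₀ : ∀ n, 0 ≤ x n) (hxw : ∀ n, x n ≤ w) :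
    ∃ (z : ℕ → E) (c : E), (∀ n, x n ≤ z n) ∧ Tendsto z atTop (𝓝 c) ∧
      ∀ g : StrongDual ℝ E, DualNonneg g → Summable (fun n => g (x n)) → g c ≤ 0 := by
  let s : ℕ → ℕ → E := fun n => partialSups fun k => x (n + k)
  have hxs : ∀ n k, x (n + k) ≤ s n k := fun n k => le_partialSups (fun k => x (n + k)) k
  have hs₀ : ∀ n k, 0 ≤ s n k := fun n k => (h₀ _).trans (hxs n k)
  have hsw : ∀ n k, s n k ≤ w := fun n k => partialSups_le _ _ _ fun _ _ => hxw _
  have hs_mono : ∀ n, Monotone (s n) := fun n => (partialSups fun k => x (n + k)).monotone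
  choose z hz using fun n => hw (s n) (hs_mono n) (hs₀ n) (hsw n)
  have hz_anti : Antitone z := antitone_nat_of_succ_le fun n =>
    le_of_tendsto_of_tendsto' (hz (n + 1)) ((hz n).comp (tendsto_add_atTop_nat 1)) fun k =>
      partialSups_le _ _ _ fun i hi => by
        rw [add_assoc, add_comm 1]
        exact (hxs n (i + 1)).trans (hs_mono n (Nat.succ_le_succ hi))
  obtain ⟨c, hc⟩ := hw.exists_tendsto_of_antitone hz_anti
    (fun n => ge_of_tendsto' (hz n) (hs₀ n)) (fun n => le_of_tendsto' (hz n) (hsw n))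
  refine ⟨z, c, fun n => (hxs n 0).trans ((hs_mono n).ge_of_tendsto (hz n) 0), hc,
    fun g hg hgx => ?_⟩
  refine le_of_tendsto_of_tendsto' ((g.continuous.tendsto c).comp hc)
    (tendsto_sum_nat_add fun n => g (x n)) fun n => ?_
  refine le_of_tendsto' ((g.continuous.tendsto (z n)).comp (hz n)) fun k => ?_
  calc g (s n k) ≤ g (∑ i ∈ Finset.range (k + 1), x (n + i)) :=
        hg.monotone (partialSups_le _ _ _ fun i hi => Finset.single_le_sum
          (f := fun i => x (n + i)) (fun _ _ => h₀ _) (Finset.mem_range.2 (Nat.lt_succ_of_le hi)))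
    _ = ∑ i ∈ Finset.range (k + 1), g (x (i + n)) := by simp only [map_sum, add_comm n]
    _ ≤ ∑' i, g (x (i + n)) :=
        ((summable_nat_add_iff n).2 hgx).sum_le_tsum _ fun _ _ => hg _ (h₀ _)

variable [IsOrderedModule ℝ E]

/-- Otherwise some `x n ∈ [0, w]` of norm at least `ε` would be almost annihilated by the norming
functionals of `x 0, …, x (n - 1)`, and hence so would be their upper limit. -/
theorem MonotoneConvergesBelow.exists_norm_le {w : E} (hw : MonotoneConvergesBelow w) {ε : ℝ}
    (hε : 0 < ε) :
    ∃ g : StrongDual ℝ E, DualNonneg g ∧ ∀ x, 0 ≤ x → x ≤ w → ‖x‖ ≤ g x + ε := by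
  by_contra! hc
  choose! G hG hG₁ hGx using fun (x : E) (hx : 0 ≤ x) => exists_dualNonneg_apply_eq_norm hx
  obtain ⟨x, hx, hsum⟩ := exists_seq_summable_apply (A := {x | 0 ≤ x ∧ x ≤ w ∧ ε ≤ ‖x‖}) (C := ‖w‖)
    (fun x hx => hx.1) (fun x hx => hG x hx.1) fun g hg => by
      obtain ⟨x, hx₀, hxw, hx⟩ := hc g hg
      have hxw_norm := norm_le_norm_of_nonneg hx₀ hxw
      exact ⟨x, ⟨hx₀, hxw, by linarith [hg x hx₀]⟩, by linarith⟩
  obtain ⟨z, c, hxz, hzc, hc_zero⟩ := hw.exists_limsup (fun n => (hx n).1) (fun n => (hx n).2.1)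
  have hle : ∀ n, ε ≤ ‖z n - c‖ := fun n => by
    calc ε ≤ G (x n) (x n) := (hx n).2.2.trans_eq (hGx _ (hx n).1).symm
      _ ≤ G (x n) (z n) := (hG _ (hx n).1).monotone (hxz n)
      _ ≤ G (x n) (z n - c) := by
          rw [map_sub]; linarith [hc_zero _ (hG _ (hx n).1) (hsum n)]
      _ ≤ ‖z n - c‖ := (le_abs_self _).trans
          (((G (x n)).le_of_opNorm_le (hG₁ _ (hx n).1) _).trans_eq (one_mul _))
  exact absurd (ge_of_tendsto' (tendsto_iff_norm_sub_tendsto_zero.1 hzc) hle) (not_le.2 hε)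

end OrderContinuity

section WeakCompactness

variable {E : Type u} [NormedAddCommGroup E] [NormedSpace ℝ E] [Lattice E]

/-- A Riemann sum for `N ∫₀¹ g ((y - t x)⁺) dt`, which as a function of `y ∈ [0, x]` is uniformly
convex up to the mesh of the grid. -/
noncomputable def gridSum (g : StrongDual ℝ E) (x : E) (N : ℕ) (y : E) : ℝ :=
  ∑ k ∈ Finset.range N, g (y - ((k : ℝ) / N) • x)⁺

theorem gridSum_nonneg {g : StrongDual ℝ E} (hg : DualNonneg g) (x : E) (N : ℕ) (y : E) :
    0 ≤ gridSum g x N y :=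
  Finset.sum_nonneg fun _ _ => hg _ (posPart_nonneg _)

variable [IsOrderedAddMonoid E] [IsOrderedModule ℝ E]

theorem gridSum_le {g : StrongDual ℝ E} (hg : DualNonneg g) {x y : E} (hx : 0 ≤ x) (N : ℕ)
    (hy : y ≤ x) : gridSum g x N y ≤ N * g x := by
  refine (Finset.sum_le_card_nsmul _ _ (g x) fun k _ => hg.monotone (sup_le ?_ hx)).trans_eq ?_
  · exact (sub_le_self _ (smul_nonneg (by positivity) hx)).trans hy
  · rw [Finset.card_range, nsmul_eq_mul]

theorem apply_posPart_sub_le_gridSum {g : StrongDual ℝ E} (hg : DualNonneg g) {x y z : E}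
    (hx : 0 ≤ x) {N : ℕ} (hN : 0 < N) (hy : y ≤ x) (hz : 0 ≤ z) :
    g (y - z)⁺ ≤ g x / N +
      (gridSum g x N y + gridSum g x N z - 2 * gridSum g x N (midpoint ℝ y z)) := by
  have hN' : (N : ℝ) ≠ 0 := by positivity
  let t : ℕ → E := fun k => ((k : ℝ) / N) • x
  have hd : 0 ≤ (1 / N : ℝ) • x := smul_nonneg (by positivity) hx
  have hlevels : y - z ≤ (1 / N : ℝ) • x + ∑ k ∈ Finset.range N, (y - t k)⁺ ⊓ (t k - z)⁺ := by
    refine sub_le_add_sum_posPart_inf_posPart ?_ ?_ (fun k => ?_) hd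
    · simpa only [t, Nat.cast_zero, zero_div, zero_smul] using hz
    · simpa only [t, div_self hN', one_smul] using hy
    · simp only [t, Nat.cast_succ, add_div, add_smul, le_refl]
  have hposPart : (y - z)⁺ ≤ (1 / N : ℝ) • x + ∑ k ∈ Finset.range N, (y - t k)⁺ ⊓ (t k - z)⁺ :=
    sup_le hlevels (add_nonneg hd
      (Finset.sum_nonneg fun k _ => le_inf (posPart_nonneg _) (posPart_nonneg _)))
  have hoverlap : ∀ k, g ((y - t k)⁺ ⊓ (t k - z)⁺) ≤
      g (y - t k)⁺ + g (z - t k)⁺ - 2 * g (midpoint ℝ y z - t k)⁺ := fun k => by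
    have h := hg.monotone (posPart_inf_posPart_neg_add_le (y - t k) (z - t k))
    have hmid : y - t k + (z - t k) = (2 : ℝ) • (midpoint ℝ y z - t k) := by
      rw [two_smul, sub_add_sub_comm, sub_add_sub_comm, midpoint_add_self]
    rw [neg_sub, hmid, posPart_smul two_pos, map_add, map_add, map_smul, smul_eq_mul] at h
    linarith
  calc g (y - z)⁺ ≤ g x / N + ∑ k ∈ Finset.range N, g ((y - t k)⁺ ⊓ (t k - z)⁺) := by
        refine (hg.monotone hposPart).trans_eq ?_
        rw [map_add, map_smul, map_sum, smul_eq_mul, one_div_mul_eq_div]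
    _ ≤ g x / N + ∑ k ∈ Finset.range N,
          (g (y - t k)⁺ + g (z - t k)⁺ - 2 * g (midpoint ℝ y z - t k)⁺) := by
        gcongr with k; exact hoverlap k
    _ = _ := by
        rw [Finset.sum_sub_distrib, Finset.sum_add_distrib, ← Finset.mul_sum]; rfl

variable [HasSolidNorm E]

theorem MonotoneConvergesBelow.exists_uniformlyConvex {x : E} (hx : MonotoneConvergesBelow x)
    (hx₀ : 0 ≤ x) {ε : ℝ} (hε : 0 < ε) :
    ∃ F : E → ℝ, ∃ C η, 0 < η ∧ (∀ y ∈ Set.Icc 0 x, F y ∈ Set.Icc 0 C) ∧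
      ∀ y ∈ Set.Icc 0 x, ∀ z ∈ Set.Icc 0 x,
        F y + F z - 2 * F (midpoint ℝ y z) ≤ η → ‖y - z‖ ≤ ε := by
  obtain ⟨g, hg, hgx⟩ := hx.exists_norm_le (ε := ε / 6) (by positivity)
  obtain ⟨N, hN⟩ := exists_nat_gt (g x / (ε / 6))
  have hN₀ : (0 : ℝ) < N := (div_nonneg (hg x hx₀) (by positivity)).trans_lt hN
  have hgN : g x / N ≤ ε / 6 := ((div_lt_comm₀ (by positivity) hN₀).1 hN).le
  have hpart : ∀ y ∈ Set.Icc 0 x, ∀ z ∈ Set.Icc 0 x, gridSum g x N y + gridSum g x N z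
      - 2 * gridSum g x N (midpoint ℝ y z) ≤ ε / 6 → ‖(y - z)⁺‖ ≤ ε / 2 := fun y hy z hz h => by
    have hnorm := hgx _ (posPart_nonneg (y - z)) (sup_le ((sub_le_self y hz.1).trans hy.2) hx₀)
    have hgrid := apply_posPart_sub_le_gridSum hg hx₀ (Nat.cast_pos.1 hN₀) hy.2 hz.1
    linarith
  refine ⟨gridSum g x N, N * g x, ε / 6, by positivity, fun y hy =>
    ⟨gridSum_nonneg hg x N y, gridSum_le hg hx₀ N hy.2⟩, fun y hy z hz h => ?_⟩
  have hyz := hpart y hy z hz h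
  have hzy := hpart z hz y hy (by rwa [midpoint_comm, add_comm (gridSum g x N z)])
  calc ‖y - z‖ = ‖(y - z)⁺ - (z - y)⁺‖ := by
        rw [← neg_sub y z, posPart_neg, posPart_sub_negPart]
    _ ≤ ‖(y - z)⁺‖ + ‖(z - y)⁺‖ := norm_sub_le _ _
    _ ≤ ε := by linarith

variable {x : E} {ι : Type*} [Nonempty ι] {K : ι → Set E}

/-- Near minimizers of a uniformly convex function on far members of the family are close. -/
theorem MonotoneConvergesBelow.exists_approx_common_point (hx : MonotoneConvergesBelow x)
    (hdir : Directed (· ⊇ ·) K) (hconv : ∀ i, Convex ℝ (K i)) (hne : ∀ i, (K i).Nonempty)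
    (hsub : ∀ i, K i ⊆ Set.Icc 0 x) {ε : ℝ} (hε : 0 < ε) :
    ∃ y, ∀ j, (K j ∩ Metric.closedBall y ε).Nonempty := by
  have hx₀ : 0 ≤ x := by
    obtain ⟨y, hy⟩ := hne (Classical.arbitrary ι)
    exact (hsub _ hy).1.trans (hsub _ hy).2
  obtain ⟨F, C, η, hη, hF, hFε⟩ := hx.exists_uniformlyConvex hx₀ hε
  let lower : Set ℝ := {r | ∃ i, ∀ y ∈ K i, r ≤ F y}
  have hbdd : BddAbove lower := ⟨C, by
    rintro r ⟨i, hi⟩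
    obtain ⟨y, hy⟩ := hne i
    exact (hi y hy).trans (hF y (hsub i hy)).2⟩
  have hlower : lower.Nonempty := ⟨0, Classical.arbitrary ι, fun y hy => (hF y (hsub _ hy)).1⟩
  obtain ⟨r, ⟨i, hi⟩, hr⟩ := exists_lt_of_lt_csSup hlower
    (sub_lt_self (sSup lower) (show 0 < η / 4 by positivity))
  have hnear : ∀ l, ∃ z ∈ K l, F z < sSup lower + η / 4 := fun l => by
    by_contra! h
    linarith [le_csSup hbdd ⟨l, h⟩]
  obtain ⟨y, hy, hFy⟩ := hnear i
  refine ⟨y, fun j => ?_⟩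
  obtain ⟨l, hli, hlj⟩ := hdir i j
  obtain ⟨z, hz, hFz⟩ := hnear l
  have hmid := hi _ ((hconv i).midpoint_mem (hli hz) hy)
  exact ⟨z, hlj hz, mem_closedBall_iff_norm.2
    (hFε z (hsub l hz) y (hsub i hy) (by linarith))⟩

theorem exists_forall_mem_of_antitone_of_subset_closedBall {X ι : Type*} [MetricSpace X]
    [CompleteSpace X] [Nonempty ι] {K : ι → Set X} {B : ℕ → Set X} {y : ℕ → X} {r : ℕ → ℝ}
    (hK : ∀ i, IsClosed (K i)) (hB : Antitone B) (hne : ∀ i n, (K i ∩ B n).Nonempty)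
    (hBy : ∀ n, B n ⊆ Metric.closedBall (y n) (r n)) (hr : Tendsto r atTop (𝓝 0)) :
    ∃ a, ∀ i, a ∈ K i := by
  choose z hzK hzB using hne
  have hdist : ∀ i j m n N, N ≤ m → N ≤ n → dist (z i m) (z j n) ≤ r N + r N :=
    fun i j m n N hm hn => (dist_triangle_right _ _ (y N)).trans
      (add_le_add (hBy N (hB hm (hzB i m))) (hBy N (hB hn (hzB j n))))
  have hr₂ : Tendsto (fun n => r n + r n) atTop (𝓝 0) := by
    simpa only [add_zero] using hr.add hr
  let i₀ := Classical.arbitrary ι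
  obtain ⟨a, ha⟩ := cauchySeq_tendsto_of_complete
    (cauchySeq_of_le_tendsto_0 (fun n => r n + r n) (hdist i₀ i₀) hr₂)
  refine ⟨a, fun i => (hK i).mem_of_tendsto (ha.congr_dist ?_) (Eventually.of_forall (hzK i))⟩
  exact squeeze_zero (fun _ => dist_nonneg) (fun n => hdist i₀ i n n n le_rfl le_rfl) hr₂

/-- In other words, `[0, x]` is weakly compact. -/
theorem MonotoneConvergesBelow.exists_common_point [CompleteSpace E]
    (hx : MonotoneConvergesBelow x) (hdir : Directed (· ⊇ ·) K) (hconv : ∀ i, Convex ℝ (K i))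
    (hclosed : ∀ i, IsClosed (K i)) (hne : ∀ i, (K i).Nonempty) (hsub : ∀ i, K i ⊆ Set.Icc 0 x) :
    ∃ y, ∀ i, y ∈ K i := by
  let P : Set E → Prop := fun B => Convex ℝ B ∧ ∀ j, (K j ∩ B).Nonempty
  have hstep : ∀ (n : ℕ) (B : {B // P B}), ∃ B' : {B // P B}, B'.1 ⊆ B ∧
      ∃ y, B'.1 ⊆ Metric.closedBall y ((1 / 2) ^ n) := fun n B => by
    obtain ⟨y, hy⟩ := hx.exists_approx_common_point (K := fun j => K j ∩ B)
      (fun i j => (hdir i j).imp fun l hl =>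
        ⟨Set.inter_subset_inter_left _ hl.1, Set.inter_subset_inter_left _ hl.2⟩)
      (fun j => (hconv j).inter B.2.1) B.2.2 (fun j => Set.inter_subset_left.trans (hsub j))
      (show (0 : ℝ) < (1 / 2) ^ n by positivity)
    exact ⟨⟨B ∩ Metric.closedBall y ((1 / 2) ^ n), B.2.1.inter (convex_closedBall _ _),
      fun j => Set.inter_assoc (K j) _ _ ▸ hy j⟩, Set.inter_subset_left, y, Set.inter_subset_right⟩
  choose s hs y hsy using hstep
  let B : ℕ → {B // P B} := fun n =>
    Nat.rec ⟨Set.univ, convex_univ, fun j => (hne j).mono (Set.subset_inter subset_rfl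
      (Set.subset_univ _))⟩ s n
  have hB : ∀ n, (B (n + 1)).1 ⊆ Metric.closedBall (y n (B n)) ((1 / 2) ^ n) := fun n =>
    hsy n (B n)
  have hanti : Antitone fun n => (B n).1 := antitone_nat_of_succ_le fun n => hs n (B n)
  exact exists_forall_mem_of_antitone_of_subset_closedBall hclosed
    (fun _ _ h => hanti (Nat.succ_le_succ h)) (fun j n => (B (n + 1)).2.2 j) hB
    (tendsto_pow_atTop_nhds_zero_of_lt_one (by norm_num) (by norm_num))

end WeakCompactness

section Truncation

theorem exists_forall_apply_lt_add_of_convex {E κ : Type*} [AddCommGroup E] [Module ℝ E]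
    [Fintype κ] {S : Set E} (hS : Convex ℝ S) (g : κ → E →ₗ[ℝ] ℝ) (r : κ → ℝ)
    (h : ∀ l : κ → ℝ, (∀ i, 0 ≤ l i) → ∀ s, (∀ y ∈ S, s ≤ ∑ i, l i * g i y) → s ≤ ∑ i, l i * r i)
    {δ : ℝ} (hδ : 0 < δ) : ∃ y ∈ S, ∀ i, g i y < r i + δ := by
  classical
  by_contra! hempty
  let Q : Set (κ → ℝ) := Set.univ.pi fun i => Set.Iio (r i + δ)
  have hQ : ∀ v ≤ r, v ∈ Q := fun v hv i _ => (hv i).trans_lt (lt_add_of_pos_right _ hδ)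
  have hdisj : Disjoint Q (LinearMap.pi g '' S) := by
    refine Set.disjoint_left.2 ?_
    rintro _ hv ⟨y, hy, rfl⟩
    obtain ⟨i, hi⟩ := hempty y hy
    exact hi.not_gt (hv i trivial)
  obtain ⟨L, s, hLQ, hLS⟩ := geometric_hahn_banach_open (convex_pi fun i _ => convex_Iio (r i + δ))
    (isOpen_set_pi Set.finite_univ fun i _ => isOpen_Iio) (hS.linear_image (LinearMap.pi g)) hdisj
  let l : κ → ℝ := fun i => L (Pi.single i 1)
  have hL : ∀ v, L v = ∑ i, l i * v i := fun v => by
    refine (L.toLinearMap.pi_apply_eq_sum_univ v).trans (Finset.sum_congr rfl fun i _ => ?_)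
    rw [smul_eq_mul, mul_comm, ContinuousLinearMap.coe_coe]
    congr 2
    ext j
    simp only [Pi.single_apply, eq_comm]
  have hl : ∀ i, 0 ≤ l i := fun i => by
    by_contra! hi
    have hr := hLQ r (hQ r le_rfl)
    have hlt := hLQ (r - ((s - L r) / -l i) • Pi.single i 1)
      (hQ _ (sub_le_self r (smul_nonneg (div_nonneg (by linarith) (by linarith))
        (Pi.single_nonneg.2 zero_le_one))))
    rw [map_sub, map_smul, smul_eq_mul, div_neg, neg_mul, div_mul_cancel₀ _ hi.ne] at hlt
    linarith
  refine (hLQ r (hQ r le_rfl)).not_ge (hL r ▸ h l hl s fun y hy => ?_)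
  exact (hLS _ ⟨y, hy, rfl⟩).trans_eq (hL _)

variable {E : Type u} [NormedAddCommGroup E] [NormedSpace ℝ E] [Lattice E]
  [IsOrderedAddMonoid E] [IsOrderedModule ℝ E] [HasSolidNorm E]
  {φ : StrongDual ℝ (StrongDual ℝ E)}

theorem DominatedBy.le_of_forall_le_apply_sub (hφ : BidualNonneg φ) {c : ℝ} (hc : 0 ≤ c) {x : E}
    (hx₀ : 0 ≤ x) (hx : DominatedBy φ c x) {p q : StrongDual ℝ E} (hp : DualNonneg p)
    (hq : DualNonneg q) {s : ℝ} (hs : ∀ y ∈ Set.Icc 0 x, s ≤ p y - q y) :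
    s ≤ φ p + c * ‖q‖ - q x := by
  obtain ⟨k, hk, hpk, hqk, hkx⟩ := hp.exists_inf hq (r := s + q x)
    (fun y hy hyx => by rw [map_sub]; linarith [hs y ⟨hy, hyx⟩]) hx₀
  have hφk : φ k ≤ φ p := by
    rw [← sub_nonneg, ← map_sub]
    exact hφ _ hpk
  have hck : c * ‖k‖ ≤ c * ‖q‖ :=
    mul_le_mul_of_nonneg_left (norm_le_of_dualNonneg_sub hk hqk) hc
  linarith [hx k hk]

theorem DominatedBy.exists_finite_truncation (hφ : BidualNonneg φ) {c : ℝ} (hc : 0 ≤ c)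
    {x : E} (hx₀ : 0 ≤ x) (hx : DominatedBy φ c x) {I : Finset (StrongDual ℝ E)}
    (hI : ∀ f ∈ I, DualNonneg f) {δ : ℝ} (hδ : 0 < δ) :
    ∃ y ∈ Set.Icc 0 x, ∀ f ∈ I, f y ≤ φ f + δ ∧ f (x - y) ≤ c * ‖f‖ + δ := by
  let g : I ⊕ I → E →ₗ[ℝ] ℝ := Sum.elim (fun f => f.1) fun f => -(f.1 : E →ₗ[ℝ] ℝ)
  let r : I ⊕ I → ℝ := Sum.elim (fun f => φ f.1) fun f => c * ‖f.1‖ - f.1 x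
  have hweights : ∀ l : I ⊕ I → ℝ, (∀ i, 0 ≤ l i) → ∀ s,
      (∀ y ∈ Set.Icc 0 x, s ≤ ∑ i, l i * g i y) → s ≤ ∑ i, l i * r i := fun l hl s hs => by
    let p : StrongDual ℝ E := ∑ f : I, l (.inl f) • f.1
    let q : StrongDual ℝ E := ∑ f : I, l (.inr f) • f.1
    have hq : ‖q‖ ≤ ∑ f : I, l (.inr f) * ‖f.1‖ := norm_sum_le_of_le _ fun f _ => by
      rw [norm_smul, Real.norm_of_nonneg (hl _)]
    calc s ≤ φ p + c * ‖q‖ - q x := by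
          refine hx.le_of_forall_le_apply_sub hφ hc hx₀
            (DualNonneg.sum fun f _ => (hI _ f.2).smul (hl _))
            (DualNonneg.sum fun f _ => (hI _ f.2).smul (hl _)) fun y hy => (hs y hy).trans_eq ?_
          simp [g, Fintype.sum_sum_type, sub_eq_add_neg]
      _ ≤ φ p + c * ∑ f : I, l (.inr f) * ‖f.1‖ - q x := by gcongr
      _ = ∑ i, l i * r i := by
          simp [r, p, q, Fintype.sum_sum_type, mul_sub, Finset.mul_sum, mul_left_comm,
            add_sub_assoc]
  obtain ⟨y, hy, h⟩ := exists_forall_apply_lt_add_of_convex (convex_Icc 0 x) g r hweights hδ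
  refine ⟨y, hy, fun f hf => ⟨(h (.inl ⟨f, hf⟩)).le, ?_⟩⟩
  have hxy : -f y < c * ‖f‖ - f x + δ := h (.inr ⟨f, hf⟩)
  rw [map_sub]
  linarith

/-- Weak compactness of `[0, x]` solves all the inequalities of `exists_finite_truncation` at
once. -/
theorem DominatedBy.exists_truncation_add_one [CompleteSpace E] (hφ : BidualNonneg φ) {c : ℝ}
    (hc : 0 ≤ c) {x : E} (hx₀ : 0 ≤ x) (hx : DominatedBy φ c x) (hmono : MonotoneConvergesBelow x) :
    ∃ y ∈ Set.Icc 0 x, ∀ f, DualNonneg f → f y ≤ φ f + 1 ∧ f (x - y) ≤ c * ‖f‖ + 1 := by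
  classical
  let K : Finset {f : StrongDual ℝ E // DualNonneg f} → Set E := fun I =>
    Set.Icc 0 x ∩ ⋂ f ∈ I, {y | f.1 y ≤ φ f.1 + 1} ∩ {y | f.1 x - (c * ‖f.1‖ + 1) ≤ f.1 y}
  have hanti : Antitone K := fun I J hIJ => Set.inter_subset_inter_right _
    (Set.biInter_subset_biInter_left hIJ)
  obtain ⟨y, hy⟩ := hmono.exists_common_point (K := K) hanti.directed_ge
    (fun I => (convex_Icc 0 x).inter (convex_iInter₂ fun f _ =>
      (convex_halfSpace_le f.1.isLinear _).inter (convex_halfSpace_ge f.1.isLinear _)))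
    (fun I => isClosed_Icc.inter (isClosed_biInter fun f _ =>
      (isClosed_le f.1.continuous continuous_const).inter
        (isClosed_le continuous_const f.1.continuous)))
    (fun I => by
      obtain ⟨y, hy, h⟩ := hx.exists_finite_truncation hφ hc hx₀ (I := I.image Subtype.val)
        (fun f hf => by obtain ⟨f, -, rfl⟩ := Finset.mem_image.1 hf; exact f.2) one_pos
      refine ⟨y, hy, Set.mem_iInter₂.2 fun f hf => ?_⟩
      have hf' := h f.1 (Finset.mem_image_of_mem _ hf)
      rw [map_sub] at hf'
      exact ⟨hf'.1, sub_le_comm.1 hf'.2⟩)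
    (fun I => Set.inter_subset_left)
  refine ⟨y, (hy ∅).1, fun f hf => ?_⟩
  have hyf := Set.mem_iInter₂.1 (hy {⟨f, hf⟩}).2 ⟨f, hf⟩ (Finset.mem_singleton_self _)
  rw [map_sub]
  exact ⟨hyf.1, sub_le_comm.1 hyf.2⟩

/-- The error `1` disappears because the inequalities hold for all multiples of a functional. -/
theorem DominatedBy.exists_truncation [CompleteSpace E] (hφ : BidualNonneg φ) {c : ℝ} (hc : 0 ≤ c)
    {x : E} (hx₀ : 0 ≤ x) (hx : DominatedBy φ c x) (hmono : MonotoneConvergesBelow x) :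
    ∃ y ∈ Set.Icc 0 x, DominatedBy φ 0 y ∧ ‖x - y‖ ≤ c := by
  obtain ⟨y, hyx, hy⟩ := hx.exists_truncation_add_one hφ hc hx₀ hmono
  have hscale : ∀ f, DualNonneg f → ∀ ε : ℝ, 0 < ε → f y ≤ φ f + ε ∧ f (x - y) ≤ c * ‖f‖ + ε :=
    fun f hf ε hε => by
      have hεf := hy (ε⁻¹ • f) (hf.smul (by positivity))
      simp only [_root_.smul_apply, map_smul, smul_eq_mul, norm_smul, norm_inv,
        Real.norm_of_nonneg hε.le] at hεf
      field_simp at hεf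
      exact ⟨hεf.1, by linarith [hεf.2]⟩
  refine ⟨y, hyx, dominatedBy_zero_iff.2 fun f hf =>
    le_of_forall_pos_le_add fun ε hε => (hscale f hf ε hε).1, ?_⟩
  refine norm_le_of_dualNonneg (sub_nonneg.2 hyx.2) fun f hf hf₁ => ?_
  exact (le_of_forall_pos_le_add fun ε hε => (hscale f hf ε hε).2).trans
    (mul_le_of_le_one_right hc hf₁)

end Truncation

section Disjoint

variable {E : Type u} [NormedAddCommGroup E] [Lattice E]

theorem subset_solidClosure_self (A : Set E) : A ⊆ solidClosure A := fun x hx => ⟨x, hx, le_rfl⟩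

theorem pairwise_inf_eq_zero_of_lt {x : ℕ → E} (h₀ : ∀ n, 0 ≤ x n)
    (h : ∀ m n, m < n → x m ⊓ x n ≤ 0) : Pairwise fun m n => x m ⊓ x n = 0 := by
  intro m n hmn
  refine le_antisymm ?_ (le_inf (h₀ m) (h₀ n))
  rcases hmn.lt_or_gt with hlt | hlt
  · exact h m n hlt
  · exact inf_comm (x m) (x n) ▸ h n m hlt

variable [IsOrderedAddMonoid E]

theorem sum_range_inf_eq_zero {x : ℕ → E} (h₀ : ∀ n, 0 ≤ x n)
    (hx : Pairwise fun m n => x m ⊓ x n = 0) {N n : ℕ} (hn : N ≤ n) :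
    (∑ k ∈ Finset.range N, x k) ⊓ x n = 0 := by
  induction N with
  | zero => rw [Finset.sum_range_zero, inf_eq_left.2 (h₀ n)]
  | succ N ih =>
    have hsum : 0 ≤ ∑ k ∈ Finset.range N, x k := Finset.sum_nonneg fun k _ => h₀ k
    refine le_antisymm ?_ (le_inf (Finset.sum_nonneg fun k _ => h₀ k) (h₀ n))
    rw [Finset.sum_range_succ, inf_comm]
    refine (inf_add_le_inf_add_inf (h₀ n) hsum (h₀ N)).trans_eq ?_
    rw [inf_comm, ih (Nat.le_of_succ_le hn), hx (Nat.lt_of_succ_le hn).ne', add_zero]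

/-- The partial sums of a disjoint sequence are also its partial suprema. -/
theorem MonotoneConvergesBelow.tendsto_zero_of_disjoint {w : E} (hw : MonotoneConvergesBelow w)
    {x : ℕ → E} (h₀ : ∀ n, 0 ≤ x n) (hxw : ∀ n, x n ≤ w)
    (hx : Pairwise fun m n => x m ⊓ x n = 0) : Tendsto x atTop (𝓝 0) := by
  let s : ℕ → E := fun N => ∑ k ∈ Finset.range N, x k
  have hs_succ : ∀ N, s (N + 1) = s N + x N := fun N => Finset.sum_range_succ x N
  have hsw : ∀ N, s N ≤ w := by
    intro N
    induction N with
    | zero => exact (h₀ 0).trans (hxw 0)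
    | succ N ih =>
      have hsup : s (N + 1) = s N ⊔ x N := by
        rw [hs_succ, ← inf_add_sup, sum_range_inf_eq_zero h₀ hx le_rfl, zero_add]
      exact hsup ▸ sup_le ih (hxw N)
  obtain ⟨a, ha⟩ := hw s
    (monotone_nat_of_le_succ fun N => hs_succ N ▸ le_add_of_nonneg_right (h₀ N))
    (fun N => Finset.sum_nonneg fun k _ => h₀ k) hsw
  have hdiff := (ha.comp (tendsto_add_atTop_nat 1)).sub ha
  simpa only [Function.comp_apply, hs_succ, add_sub_cancel_left, sub_self] using hdiff

theorem pairwise_crossing_inf_eq_zero {x : ℕ → E} (hx : Monotone x) (c : E) :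
    Pairwise fun m n => (x (m + 1) - c)⁺ ⊓ (c - x m)⁺ ⊓ ((x (n + 1) - c)⁺ ⊓ (c - x n)⁺) = 0 := by
  refine pairwise_inf_eq_zero_of_lt (x := fun n => (x (n + 1) - c)⁺ ⊓ (c - x n)⁺)
    (fun n => le_inf (posPart_nonneg _) (posPart_nonneg _)) fun m n hmn => ?_
  calc (x (m + 1) - c)⁺ ⊓ (c - x m)⁺ ⊓ ((x (n + 1) - c)⁺ ⊓ (c - x n)⁺)
      ≤ (x (m + 1) - c)⁺ ⊓ (c - x n)⁺ := inf_le_inf inf_le_left inf_le_right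
    _ ≤ (x n - c)⁺ ⊓ (c - x n)⁺ := by
        gcongr
        exact posPart_mono (sub_le_sub_right (hx hmn) c)
    _ = 0 := by rw [← neg_sub (x n) c, posPart_inf_posPart_neg]

theorem IsLWeaklyCompact.tendsto_zero_of_nonneg {A : Set E} (hA : IsLWeaklyCompact A) {x : ℕ → E}
    (hxA : ∀ n, x n ∈ solidClosure A) (h₀ : ∀ n, 0 ≤ x n)
    (hx : Pairwise fun m n => x m ⊓ x n = 0) : Tendsto x atTop (𝓝 0) :=
  hA.2 x hxA fun m n hmn => by simpa only [abs_of_nonneg (h₀ _)] using hx hmn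

variable [HasSolidNorm E] [NormedSpace ℝ E] [IsOrderedModule ℝ E]

/-- An increment of a sequence in `[0, w]` is at most `w / N` plus its crossings of the levels
`k w / N` for `k < N`. -/
theorem tendsto_dist_succ_of_tendsto_crossing {w : E} {x : ℕ → E} (hx : Monotone x)
    (h₀ : ∀ n, 0 ≤ x n) (hxw : ∀ n, x n ≤ w)
    (h : ∀ c, 0 ≤ c → Tendsto (fun n => (x (n + 1) - c)⁺ ⊓ (c - x n)⁺) atTop (𝓝 0)) :
    Tendsto (fun n => dist (x (n + 1)) (x n)) atTop (𝓝 0) := by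
  refine Metric.tendsto_nhds.2 fun ε hε => ?_
  obtain ⟨N, hN⟩ := exists_nat_gt (‖w‖ / (ε / 2))
  have hN₀ : (0 : ℝ) < N := (by positivity : (0 : ℝ) ≤ ‖w‖ / (ε / 2)).trans_lt hN
  let d : E := (N : ℝ)⁻¹ • w
  let s : ℕ → E := fun n => ∑ k ∈ Finset.range N, (x (n + 1) - k • d)⁺ ⊓ (k • d - x n)⁺
  have hd : 0 ≤ d := smul_nonneg (by positivity) ((h₀ 0).trans (hxw 0))
  have hd_norm : ‖d‖ < ε / 2 := by
    rw [norm_smul, norm_inv, Real.norm_natCast, inv_mul_lt_iff₀ hN₀]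
    exact (div_lt_iff₀ (half_pos hε)).1 hN
  have hdN : N • d = w := by rw [← Nat.cast_smul_eq_nsmul ℝ, smul_inv_smul₀ hN₀.ne']
  have hs : Tendsto s atTop (𝓝 0) := by
    simpa only [Finset.sum_const_zero] using
      tendsto_finsetSum (Finset.range N) fun k _ => h (k • d) (nsmul_nonneg hd k)
  filter_upwards [NormedAddGroup.tendsto_nhds_zero.1 hs (ε / 2) (half_pos hε)] with n hn
  have hincr : x (n + 1) - x n ≤ d + s n :=
    sub_le_add_sum_posPart_inf_posPart (by rw [zero_nsmul]; exact h₀ n) (hdN ▸ hxw (n + 1))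
      (fun k => (succ_nsmul d k).le) hd
  rw [dist_eq_norm, sub_zero, Real.norm_of_nonneg dist_nonneg, dist_eq_norm]
  calc ‖x (n + 1) - x n‖ ≤ ‖d + s n‖ :=
        norm_le_norm_of_nonneg (sub_nonneg.2 (hx n.le_succ)) hincr
    _ ≤ ‖d‖ + ‖s n‖ := norm_add_le _ _
    _ < ε := by linarith

/-- The crossings of a fixed level are disjoint. -/
theorem IsLWeaklyCompact.monotoneConvergesBelow [CompleteSpace E] {A : Set E}
    (hA : IsLWeaklyCompact A) {w : E} (hwA : w ∈ solidClosure A) (hw : 0 ≤ w) :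
    MonotoneConvergesBelow w := by
  intro x hx h₀ hxw
  refine cauchySeq_tendsto_of_complete (cauchySeq_of_tendsto_dist_subseq fun σ hσ => ?_)
  have hxσ : Monotone (x ∘ σ) := hx.comp hσ.monotone
  refine tendsto_dist_succ_of_tendsto_crossing hxσ (fun n => h₀ _) (fun n => hxw _) fun c hc => ?_
  have hv₀ : ∀ n, 0 ≤ (x (σ (n + 1)) - c)⁺ ⊓ (c - x (σ n))⁺ := fun n =>
    le_inf (posPart_nonneg _) (posPart_nonneg _)
  refine hA.tendsto_zero_of_nonneg (fun n => isSolid_solidClosure A hwA ?_) hv₀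
    (pairwise_crossing_inf_eq_zero hxσ c)
  rw [Function.comp_apply, Function.comp_apply, abs_of_nonneg (hv₀ n), abs_of_nonneg hw]
  exact inf_le_left.trans (sup_le ((sub_le_self _ hc).trans (hxw _)) hw)

end Disjoint

section KBSpaceOfLWeaklyCompact

variable {E : Type u} [NormedAddCommGroup E] [NormedSpace ℝ E] [Lattice E] [IsOrderedAddMonoid E]

theorem pairwise_posPart_sub_inf_eq_zero [IsOrderedModule ℝ E] {x w : ℕ → E} {u : E}
    (hx₀ : ∀ n, 0 ≤ x n) (hw₀ : ∀ n, 0 ≤ w n) (hu : ∀ n, (2⁻¹ : ℝ) ^ n • x n ≤ u)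
    (hxw : ∀ m n, m < n → (4 : ℝ) ^ n • x m ≤ w n) :
    Pairwise fun m n =>
      (x m - w m - (2⁻¹ : ℝ) ^ m • u)⁺ ⊓ (x n - w n - (2⁻¹ : ℝ) ^ n • u)⁺ = 0 := by
  have hu₀ : ∀ n : ℕ, 0 ≤ (2⁻¹ : ℝ) ^ n • u := fun n =>
    smul_nonneg (by positivity) ((smul_nonneg (by positivity) (hx₀ 0)).trans (hu 0))
  refine pairwise_inf_eq_zero_of_lt (x := fun n => (x n - w n - (2⁻¹ : ℝ) ^ n • u)⁺)
    (fun n => posPart_nonneg _) fun m n hmn => ?_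
  have hm : (x m - w m - (2⁻¹ : ℝ) ^ m • u)⁺ ≤ (x m - (4⁻¹ : ℝ) ^ n • x n)⁺ := by
    refine posPart_mono (sub_le_sub (sub_le_self _ (hw₀ m)) ?_)
    calc (4⁻¹ : ℝ) ^ n • x n = (2⁻¹ : ℝ) ^ n • (2⁻¹ : ℝ) ^ n • x n := by
          rw [smul_smul, ← mul_pow]; norm_num
      _ ≤ (2⁻¹ : ℝ) ^ n • u := smul_le_smul_of_nonneg_left (hu n) (by positivity)
      _ ≤ (2⁻¹ : ℝ) ^ m • u := smul_le_smul_of_nonneg_right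
          (pow_le_pow_of_le_one (by norm_num) (by norm_num) hmn.le)
          ((smul_nonneg (by positivity) (hx₀ 0)).trans (hu 0))
  have hn : (x n - w n - (2⁻¹ : ℝ) ^ n • u)⁺ ≤ (x n - (4 : ℝ) ^ n • x m)⁺ :=
    posPart_mono ((sub_le_self _ (hu₀ n)).trans (sub_le_sub_left (hxw m n hmn) _))
  have hscale : (4 : ℝ) ^ n • (x m - (4⁻¹ : ℝ) ^ n • x n) = (4 : ℝ) ^ n • x m - x n := by
    rw [smul_sub, smul_smul, ← mul_pow, mul_inv_cancel₀ four_ne_zero, one_pow, one_smul]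
  calc (x m - w m - (2⁻¹ : ℝ) ^ m • u)⁺ ⊓ (x n - w n - (2⁻¹ : ℝ) ^ n • u)⁺
      ≤ (x m - (4⁻¹ : ℝ) ^ n • x n)⁺ ⊓ (x n - (4 : ℝ) ^ n • x m)⁺ := inf_le_inf hm hn
    _ ≤ ((4 : ℝ) ^ n • (x m - (4⁻¹ : ℝ) ^ n • x n)⁺) ⊓ (x n - (4 : ℝ) ^ n • x m)⁺ := by
        gcongr
        exact le_smul_of_one_le_left (posPart_nonneg _) (one_le_pow₀ (by norm_num))
    _ = 0 := by
        rw [← posPart_smul (by positivity), hscale, ← neg_sub ((4 : ℝ) ^ n • x m),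
          posPart_inf_posPart_neg]

theorem exists_seq_lt_norm_posPart_sub [IsOrderedModule ℝ E] {A : Set E} (hA : ∀ x ∈ A, 0 ≤ x)
    {ε : ℝ} (h : ∀ w, 0 ≤ w → ∃ x ∈ A, ε < ‖(x - w)⁺‖) :
    ∃ x w : ℕ → E, (∀ n, x n ∈ A) ∧ (∀ n, 0 ≤ w n) ∧ (∀ n, ε < ‖(x n - w n)⁺‖) ∧
      ∀ m n, m < n → (4 : ℝ) ^ n • x m ≤ w n := by
  obtain ⟨a, ha, haw⟩ := exists_seq_of_forall_nat_finset_exists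
    (fun a : E × E => a.1 ∈ A ∧ 0 ≤ a.2 ∧ ε < ‖(a.1 - a.2)⁺‖)
    (fun n a b => (4 : ℝ) ^ n • a.1 ≤ b.2)
    (fun a b ha _ m n hmn hab => (smul_le_smul_of_nonneg_right
      (pow_le_pow_right₀ (by norm_num) hmn) (hA _ ha.1)).trans hab) fun n s hs => by
    have hw : 0 ≤ (4 : ℝ) ^ n • ∑ a ∈ s, a.1 :=
      smul_nonneg (by positivity) (Finset.sum_nonneg fun a ha => hA _ (hs a ha).1)
    obtain ⟨x, hxA, hx⟩ := h _ hw
    refine ⟨(x, _), ⟨hxA, hw, hx⟩, fun a ha => ?_⟩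
    exact smul_le_smul_of_nonneg_left
      (Finset.single_le_sum (f := Prod.fst) (fun b hb => hA _ (hs b hb).1) ha) (by positivity)
  exact ⟨fun n => (a n).1, fun n => (a n).2, fun n => (ha n).1, fun n => (ha n).2.1,
    fun n => (ha n).2.2, haw⟩

variable [HasSolidNorm E] [IsOrderedModule ℝ E] [CompleteSpace E]

theorem exists_forall_smul_le {x : ℕ → E} (hx₀ : ∀ n, 0 ≤ x n) {C : ℝ} (hC : ∀ n, ‖x n‖ ≤ C) :
    ∃ u, ∀ n, (2⁻¹ : ℝ) ^ n • x n ≤ u := by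
  have hsum : Summable fun n => (2⁻¹ : ℝ) ^ n • x n := by
    refine Summable.of_norm_bounded (g := fun n : ℕ => (2⁻¹ : ℝ) ^ n * C)
      ((summable_geometric_of_lt_one (by norm_num) (by norm_num)).mul_right C) fun n => ?_
    rw [norm_smul, norm_pow, Real.norm_of_nonneg (by norm_num)]
    gcongr
    exact hC n
  exact ⟨_, fun n => hsum.le_tsum n fun k _ => smul_nonneg (by positivity) (hx₀ k)⟩

/-- Otherwise there are `x n ∈ A` and multiples `w n` of `x 0 + ⋯ + x (n - 1)` with
`‖(x n - w n)⁺‖ > ε`, and the parts `(x n - w n)⁺` are disjoint up to a null sequence. -/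
theorem IsLWeaklyCompact.exists_norm_posPart_sub_le {A : Set E} (hA : IsLWeaklyCompact A) {ε : ℝ}
    (hε : 0 < ε) : ∃ w, 0 ≤ w ∧ ∀ x ∈ solidClosure A, 0 ≤ x → ‖(x - w)⁺‖ ≤ ε := by
  by_contra! hc
  obtain ⟨x, w, hx, hw₀, hεx, hxw⟩ := exists_seq_lt_norm_posPart_sub
    (A := {x ∈ solidClosure A | 0 ≤ x}) (fun x hx => hx.2) fun w hw => by
      obtain ⟨x, hxA, hx₀, hx⟩ := hc w hw
      exact ⟨x, ⟨hxA, hx₀⟩, hx⟩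
  obtain ⟨C, hC⟩ := isBounded_iff_forall_norm_le.1 (isBounded_solidClosure hA.1)
  obtain ⟨u, hu⟩ := exists_forall_smul_le (fun n => (hx n).2) fun n => hC _ (hx n).1
  let z : ℕ → E := fun n => (x n - w n - (2⁻¹ : ℝ) ^ n • u)⁺
  have hu₀ : ∀ n : ℕ, 0 ≤ (2⁻¹ : ℝ) ^ n • u := fun n => smul_nonneg (by positivity)
    ((smul_nonneg (by positivity) (hx 0).2).trans (hu 0))
  have hz₀ : ∀ n, 0 ≤ z n := fun n => posPart_nonneg _
  have hzx : ∀ n, z n ≤ x n := fun n => sup_le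
    ((sub_le_self _ (hu₀ n)).trans (sub_le_self _ (hw₀ n))) (hx n).2
  have hz : Tendsto z atTop (𝓝 0) := hA.tendsto_zero_of_nonneg
    (fun n => isSolid_solidClosure A (hx n).1 (by
      rw [abs_of_nonneg (hz₀ n), abs_of_nonneg (hx n).2]; exact hzx n)) hz₀
    (pairwise_posPart_sub_inf_eq_zero (fun n => (hx n).2) hw₀ hu hxw)
  have hlim : Tendsto (fun n => z n + (2⁻¹ : ℝ) ^ n • u) atTop (𝓝 0) := by
    simpa only [zero_smul, add_zero] using hz.add ((tendsto_pow_atTop_nhds_zero_of_lt_one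
      (r := (2⁻¹ : ℝ)) (by norm_num) (by norm_num)).smul_const u)
  refine absurd (ge_of_tendsto' hlim.norm fun n => (hεx n).le.trans ?_) ?_
  · refine norm_le_norm_of_nonneg (posPart_nonneg _) (sup_le ?_ (add_nonneg (hz₀ n) (hu₀ n)))
    exact sub_le_iff_le_add.1 (le_posPart (x n - w n - (2⁻¹ : ℝ) ^ n • u))
  · rw [norm_zero]; exact not_le.2 hε

end KBSpaceOfLWeaklyCompact

section BSemiCompact

variable {E : Type u} [NormedAddCommGroup E] [NormedSpace ℝ E] [Lattice E] [IsOrderedAddMonoid E]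
  [HasSolidNorm E] [IsOrderedModule ℝ E]

theorem isKBSpace_of_isLWeaklyCompact_bInterval [CompleteSpace E]
    (h : ∀ φ : StrongDual ℝ (StrongDual ℝ E), BidualNonneg φ →
      IsLWeaklyCompact (bInterval φ : Set E)) : IsKBSpace E := by
  rintro x hx h₀ ⟨C, hC⟩
  obtain ⟨φ, hφ, hxφ⟩ := exists_bidual_dominating hx h₀ hC
  have hx_mem : ∀ n, x n ∈ solidClosure (bInterval φ : Set E) := fun n =>
    subset_solidClosure_self _ (mem_bInterval_iff_abs.2 (by rw [abs_of_nonneg (h₀ n)]; exact hxφ n))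
  refine cauchySeq_tendsto_of_complete (Metric.cauchySeq_iff'.2 fun ε hε => ?_)
  obtain ⟨w, hw₀, hw⟩ := (h φ hφ).exists_norm_posPart_sub_le (show 0 < ε / 4 by positivity)
  have hw_mem : w ∈ solidClosure (bInterval (NormedSpace.inclusionInDoubleDual ℝ E w)) :=
    subset_solidClosure_self _ (mem_bInterval_inclusion (abs_of_nonneg hw₀).le)
  obtain ⟨a, ha⟩ := (h _ (bidualNonneg_inclusion hw₀)).monotoneConvergesBelow hw_mem hw₀
    (fun n => x n ⊓ w) (fun _ _ hmn => inf_le_inf_right w (hx hmn)) (fun n => le_inf (h₀ n) hw₀)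
    fun n => inf_le_right
  obtain ⟨N, hN⟩ := Metric.cauchySeq_iff'.1 ha.cauchySeq (ε / 2) (half_pos hε)
  have htrunc : ∀ n, dist (x n) (x n ⊓ w) ≤ ε / 4 := fun n => by
    rw [dist_eq_norm, sub_inf_eq_posPart_sub]
    exact hw _ (hx_mem n) (h₀ n)
  refine ⟨N, fun n hn => (dist_triangle4_right (x n) (x N) (x n ⊓ w) (x N ⊓ w)).trans_lt ?_⟩
  linarith [htrunc n, htrunc N, hN n hn]

theorem IsKBSpace.exists_forall_le (h : IsKBSpace E) {φ : StrongDual ℝ (StrongDual ℝ E)}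
    (hφ : BidualNonneg φ) : ∃ w : E, 0 ≤ w ∧ ∀ x, DominatedBy φ 0 x → x ≤ w := by
  obtain ⟨w, hw⟩ := h.bddAbove (A := {x | 0 ≤ x ∧ DominatedBy φ 0 x})
    (fun x hx y hy => ⟨hx.1.trans le_sup_left, hx.2.sup_zero hy.2⟩) (fun x hx => hx.1)
    (isBounded_iff_forall_norm_le.2 ⟨‖φ‖ + 0, fun x hx => hx.2.norm_le le_rfl hx.1⟩)
  exact ⟨w, hw ⟨le_rfl, hφ.dominatedBy_zero⟩, fun x hx =>
    le_sup_left.trans (hw ⟨le_sup_right, hx.sup_zero hφ.dominatedBy_zero⟩)⟩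

theorem dominatedBy_abs_of_norm_sub_le {φ ψ : StrongDual ℝ (StrongDual ℝ E)}
    (hψ : ψ ∈ bidualInterval φ) {ε : ℝ} (hε : 0 ≤ ε) {x : E}
    (hx : ‖NormedSpace.inclusionInDoubleDual ℝ E x - ψ‖ ≤ ε) : DominatedBy φ (ε + ε) |x| := by
  have happrox : ∀ f : StrongDual ℝ E, |f x - ψ f| ≤ ε * ‖f‖ :=
    (NormedSpace.inclusionInDoubleDual ℝ E x - ψ).le_of_opNorm_le hx
  refine DominatedBy.sup hε hε (fun f hf => ?_) fun f hf => ?_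
  · linarith [(abs_le.1 (happrox f)).2, hψ.2 f hf]
  · rw [map_neg]
    have hψf : -φ f ≤ ψ f := hψ.1 f hf
    linarith [(abs_le.1 (happrox f)).1]

theorem IsBSemiCompact.exists_dominatedBy {A : Set E} (hA : IsBSemiCompact A) {ε : ℝ}
    (hε : 0 < ε) : ∃ φ : StrongDual ℝ (StrongDual ℝ E), BidualNonneg φ ∧
      ∀ x ∈ solidClosure A, DominatedBy φ (ε + ε) |x| := by
  obtain ⟨φ, hφ, hAφ⟩ := hA ε hε
  refine ⟨φ, hφ, ?_⟩
  rintro x ⟨a, ha, hxa⟩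
  obtain ⟨ψ, hψ, haψ⟩ := hAφ a ha
  exact (dominatedBy_abs_of_norm_sub_le hψ hε.le haψ).of_le hxa

theorem IsBSemiCompact.isBounded {A : Set E} (hA : IsBSemiCompact A) : Bornology.IsBounded A := by
  obtain ⟨φ, -, hAφ⟩ := hA.exists_dominatedBy one_pos
  refine isBounded_iff_forall_norm_le.2 ⟨‖φ‖ + (1 + 1), fun x hx => ?_⟩
  rw [← norm_abs_eq_norm]
  exact (hAφ x (subset_solidClosure_self A hx)).norm_le (by norm_num) (abs_nonneg x)

theorem IsKBSpace.isLWeaklyCompact [CompleteSpace E] (h : IsKBSpace E) {A : Set E}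
    (hA : IsBSemiCompact A) : IsLWeaklyCompact A := by
  refine ⟨hA.isBounded, fun x hxA hx => NormedAddGroup.tendsto_nhds_zero.2 fun ε hε => ?_⟩
  obtain ⟨φ, hφ, hAφ⟩ := hA.exists_dominatedBy (show 0 < ε / 4 by positivity)
  obtain ⟨w, -, hw⟩ := h.exists_forall_le hφ
  choose y hyx hyφ hxy using fun n => (hAφ _ (hxA n)).exists_truncation hφ
    (show 0 ≤ ε / 4 + ε / 4 by positivity) (abs_nonneg (x n)) (h.monotoneConvergesBelow _)
  have hy : Tendsto y atTop (𝓝 0) := (h.monotoneConvergesBelow w).tendsto_zero_of_disjoint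
    (fun n => (hyx n).1) (fun n => hw _ (hyφ n)) fun m n hmn =>
      le_antisymm ((inf_le_inf (hyx m).2 (hyx n).2).trans (hx hmn).le)
        (le_inf (hyx m).1 (hyx n).1)
  filter_upwards [NormedAddGroup.tendsto_nhds_zero.1 hy (ε / 2) (half_pos hε)] with n hn
  calc ‖x n‖ = ‖(|x n| - y n) + y n‖ := by rw [sub_add_cancel, norm_abs_eq_norm]
    _ ≤ ‖|x n| - y n‖ + ‖y n‖ := norm_add_le _ _
    _ < ε := by linarith [hxy n]

end BSemiCompact

section UawNull

variable {E : Type u} [NormedAddCommGroup E] [NormedSpace ℝ E] [Lattice E] [IsOrderedAddMonoid E]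
  [HasSolidNorm E]

theorem norm_sum_sign_smul_le {ι : Type*} {s : Finset ι} {a : ι → E} (ha : ∀ i, 0 ≤ a i)
    (t : ι → ℝ) : ‖∑ i ∈ s, (SignType.sign (t i) : ℝ) • a i‖ ≤ ‖∑ i ∈ s, a i‖ := by
  have hsign : ∀ i, |(SignType.sign (t i) : ℝ) • a i| ≤ a i := fun i => by
    rcases lt_trichotomy (t i) 0 with h | h | h
    · rw [sign_neg h, SignType.coe_neg_one, neg_one_smul, abs_neg, abs_of_nonneg (ha i)]
    · rw [h, sign_zero, SignType.coe_zero, zero_smul, abs_zero]; exact ha i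
    · rw [sign_pos h, SignType.coe_one, one_smul, abs_of_nonneg (ha i)]
  refine norm_le_norm_of_abs_le_abs ?_
  rw [abs_of_nonneg (Finset.sum_nonneg fun i _ => ha i)]
  exact (Finset.le_sum_of_subadditive _ abs_zero.le abs_add_le s _).trans
    (Finset.sum_le_sum fun i _ => hsign i)

theorem tendsto_apply_zero_of_norm_sum_le {a : ℕ → E} (ha : ∀ n, 0 ≤ a n) {C : ℝ}
    (hC : ∀ N, ‖∑ n ∈ Finset.range N, a n‖ ≤ C) (f : StrongDual ℝ E) :
    Tendsto (fun n => f (a n)) atTop (𝓝 0) := by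
  refine (tendsto_zero_iff_abs_tendsto_zero _).2
    (summable_of_sum_range_le (c := ‖f‖ * C) (fun n => abs_nonneg (f (a n)))
      fun N => ?_).tendsto_atTop_zero
  calc ∑ n ∈ Finset.range N, |f (a n)|
      = f (∑ n ∈ Finset.range N, (SignType.sign (f (a n)) : ℝ) • a n) := by
        simp only [map_sum, map_smul, smul_eq_mul, sign_mul_self]
    _ ≤ ‖f‖ * ‖∑ n ∈ Finset.range N, (SignType.sign (f (a n)) : ℝ) • a n‖ :=
        (le_abs_self _).trans (f.le_opNorm _)
    _ ≤ ‖f‖ * C := by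
        gcongr
        exact (norm_sum_sign_smul_le ha _).trans (hC N)

theorem uawTendsto_sub_of_monotone {x : ℕ → E} (hx : Monotone x) (h₀ : ∀ n, 0 ≤ x n) {C : ℝ}
    (hC : ∀ n, ‖x n‖ ≤ C) : UawTendsto (fun n => x (n + 1) - x n) atTop 0 := by
  intro y hy f
  have hstep : ∀ n, |x (n + 1) - x n - 0| = x (n + 1) - x n := fun n => by
    rw [sub_zero, abs_of_nonneg (sub_nonneg.2 (hx n.le_succ))]
  simp only [hstep]
  have hinf : ∀ n, 0 ≤ (x (n + 1) - x n) ⊓ y := fun n =>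
    le_inf (sub_nonneg.2 (hx n.le_succ)) hy
  refine tendsto_apply_zero_of_norm_sum_le (C := C) hinf (fun N => ?_) f
  refine (norm_le_norm_of_nonneg (Finset.sum_nonneg fun n _ => hinf n) ?_).trans (hC N)
  calc ∑ n ∈ Finset.range N, (x (n + 1) - x n) ⊓ y
      ≤ ∑ n ∈ Finset.range N, (x (n + 1) - x n) := Finset.sum_le_sum fun _ _ => inf_le_left
    _ = x N - x 0 := Finset.sum_range_sub x N
    _ ≤ x N := sub_le_self _ (h₀ 0)

variable [IsOrderedModule ℝ E]

theorem isKBSpace_of_forall_uawTendsto [CompleteSpace E]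
    (h : ∀ φ : StrongDual ℝ (StrongDual ℝ E), BidualNonneg φ → ∀ x : ℕ → E,
      (∀ n, x n ∈ bInterval φ) → UawTendsto x atTop 0 → Tendsto x atTop (𝓝 0)) :
    IsKBSpace E := by
  rintro x hx h₀ ⟨C, hC⟩
  obtain ⟨φ, hφ, hxφ⟩ := exists_bidual_dominating hx h₀ hC
  refine cauchySeq_tendsto_of_complete (cauchySeq_of_tendsto_dist_subseq fun σ hσ => ?_)
  have hxσ : Monotone fun k => x (σ k) := hx.comp hσ.monotone
  have hmem : ∀ k, x (σ (k + 1)) - x (σ k) ∈ bInterval φ := fun k => by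
    rw [mem_bInterval_iff_abs, abs_of_nonneg (sub_nonneg.2 (hxσ k.le_succ))]
    exact (hxφ (σ (k + 1))).of_le (sub_le_self _ (h₀ (σ k)))
  have huaw := uawTendsto_sub_of_monotone hxσ (fun k => h₀ (σ k)) fun k => hC (σ k)
  have hnull : Tendsto (fun k => x (σ (k + 1)) - x (σ k)) atTop (𝓝 0) :=
    h φ hφ (fun k => x (σ (k + 1)) - x (σ k)) hmem huaw
  simpa only [dist_eq_norm, norm_zero] using hnull.norm

theorem IsKBSpace.exists_norm_le_inf (h : IsKBSpace E) {ε : ℝ} (hε : 0 < ε)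
    {φ : StrongDual ℝ (StrongDual ℝ E)} (hφ : BidualNonneg φ) :
    ∃ (g : StrongDual ℝ E) (y : E), DualNonneg g ∧ 0 ≤ y ∧
      ∀ x ∈ bInterval φ, ‖x‖ ≤ g (|x| ⊓ y) + ε := by
  obtain ⟨w, hw₀, hw⟩ := h.exists_forall_le hφ
  obtain ⟨g, hg, hgw⟩ := (h.monotoneConvergesBelow w).exists_norm_le hε
  refine ⟨g, w, hg, hw₀, fun x hx => ?_⟩
  have hxw : |x| ≤ w := hw _ (mem_bInterval_iff_abs.1 hx)
  rw [inf_eq_left.2 hxw, ← norm_abs_eq_norm]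
  exact hgw _ (abs_nonneg x) hxw

end UawNull

section UawConvergence

variable {E : Type u} [NormedAddCommGroup E] [NormedSpace ℝ E] [Lattice E]

theorem UawTendsto.comp {ι κ : Type*} {x : ι → E} {l : Filter ι} {a : E} (h : UawTendsto x l a)
    {σ : κ → ι} {l' : Filter κ} (hσ : Tendsto σ l' l) : UawTendsto (x ∘ σ) l' a :=
  fun y hy f => (h y hy f).comp hσ

theorem tendsto_zero_of_forall_net {A : Set E}
    (h : ∀ (ι : Type w) [Preorder ι] [IsDirectedOrder ι] [Nonempty ι] (x : ι → E),
      (∀ i, x i ∈ A) → UawTendsto x atTop 0 → Tendsto x atTop (𝓝 0))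
    {x : ℕ → E} (hxA : ∀ n, x n ∈ A) (hx : UawTendsto x atTop 0) : Tendsto x atTop (𝓝 0) := by
  have hdown : Tendsto (ULift.down : ULift.{w} ℕ → ℕ) atTop atTop :=
    tendsto_atTop.2 fun n => mem_atTop (ULift.up n)
  have hup : Tendsto (ULift.up : ℕ → ULift.{w} ℕ) atTop atTop :=
    tendsto_atTop.2 fun n => mem_atTop n.down
  exact (h (ULift.{w} ℕ) (x ∘ ULift.down) (fun _ => hxA _) (hx.comp hdown)).comp hup

theorem UawTendsto.sub_const {ι : Type*} {x : ι → E} {l : Filter ι} {a : E}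
    (h : UawTendsto x l a) : UawTendsto (fun i => x i - a) l 0 := fun y hy f => by
  simpa only [sub_zero] using h y hy f

theorem UawTendsto.tendsto_zero_of_forall_norm_le_inf {A : Set E}
    (h : ∀ ε : ℝ, 0 < ε → ∃ (g : StrongDual ℝ E) (y : E), DualNonneg g ∧ 0 ≤ y ∧
      ∀ x ∈ A, ‖x‖ ≤ g (|x| ⊓ y) + ε)
    {ι : Type*} {l : Filter ι} {x : ι → E} (hxA : ∀ i, x i ∈ A) (hx : UawTendsto x l 0) :
    Tendsto x l (𝓝 0) := by
  refine NormedAddGroup.tendsto_nhds_zero.2 fun ε hε => ?_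
  obtain ⟨g, y, -, hy, hgy⟩ := h (ε / 2) (half_pos hε)
  filter_upwards [(hx y hy g).eventually (gt_mem_nhds (half_pos hε))] with i hi
  rw [sub_zero] at hi
  linarith [hgy _ (hxA i)]

theorem IsUawCompact.isRelUawCompact {A : Set E} (h : IsUawCompact A) : IsRelUawCompact A :=
  ⟨h.1, fun ι _ _ _ x hx => (h.2 ι x hx).imp fun _ ha => ha.2⟩

variable [IsOrderedAddMonoid E]

theorem UawTendsto.congr_const {ι : Type*} {x : ι → E} {l : Filter ι} {a : E}
    (h : ∀ᶠ i in l, x i = a) : UawTendsto x l a := fun y hy f =>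
  tendsto_const_nhds.congr' (h.mono fun i hi => by
    simp only [hi, sub_self, abs_zero, inf_eq_left.2 hy, map_zero])

theorem hasUawSubnetTendsto_of_frequently_eq {ι : Type u} [Preorder ι] [IsDirectedOrder ι]
    [Nonempty ι] {x : ι → E} {a : E} (h : ∃ᶠ i in atTop, x i = a) : HasUawSubnetTendsto x a := by
  have hcof : ∀ i, ∃ j, i ≤ j ∧ x j = a := frequently_atTop.1 h
  have : Nonempty {i // x i = a} := nonempty_subtype.2 h.exists
  refine ⟨{i // x i = a}, inferInstance, ⟨fun i j => ?_⟩, this, Subtype.val,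
    tendsto_atTop.2 fun i => ?_, UawTendsto.congr_const (Eventually.of_forall Subtype.prop)⟩
  · obtain ⟨k, hik, hjk⟩ := exists_ge_ge i.1 j.1
    obtain ⟨m, hkm, hm⟩ := hcof k
    exact ⟨⟨m, hm⟩, hik.trans hkm, hjk.trans hkm⟩
  · obtain ⟨j, hij, hj⟩ := hcof i
    filter_upwards [mem_atTop (⟨j, hj⟩ : {i // x i = a})] with k hk
    exact hij.trans hk

theorem UawTendsto.of_eventually_ne {x : ℕ → E} (hx : UawTendsto x atTop 0) {ι : Type*}
    {l : Filter ι} {y : ι → E} (hy : ∀ i, y i ∈ insert 0 (Set.range x))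
    (hne : ∀ n, ∀ᶠ i in l, y i ≠ x n) : UawTendsto y l 0 := by
  refine fun z hz f => NormedAddGroup.tendsto_nhds_zero.2 fun ε hε => ?_
  obtain ⟨N, hN⟩ := eventually_atTop.1 (NormedAddGroup.tendsto_nhds_zero.1 (hx z hz f) ε hε)
  filter_upwards [(eventually_all_finite (Set.finite_Iio N)).2 fun n _ => hne n] with i hi
  rcases hy i with h₀ | ⟨n, hn⟩
  · rwa [h₀, sub_self, abs_zero, inf_eq_left.2 hz, map_zero, norm_zero]
  · rw [← hn]
    exact hN n (not_lt.1 fun hnN => hi n hnN hn.symm)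

theorem isUawCompact_insert_zero_range {x : ℕ → E} (hb : Bornology.IsBounded (Set.range x))
    (hx : UawTendsto x atTop 0) : IsUawCompact (insert 0 (Set.range x)) := by
  refine ⟨hb.insert 0, fun ι _ _ _ y hy => ?_⟩
  by_cases h : ∃ n, ∃ᶠ i in atTop, y i = x n
  · obtain ⟨n, hn⟩ := h
    exact ⟨x n, Set.mem_insert_of_mem _ ⟨n, rfl⟩, hasUawSubnetTendsto_of_frequently_eq hn⟩
  · exact ⟨0, Set.mem_insert _ _, ι, inferInstance, inferInstance, inferInstance, id, tendsto_id,
      hx.of_eventually_ne hy fun n => not_frequently.1 fun hn => h ⟨n, hn⟩⟩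

end UawConvergence

section UawCompact

variable {E : Type u} [NormedAddCommGroup E] [NormedSpace ℝ E] [Lattice E] [IsOrderedAddMonoid E]
  [HasSolidNorm E] [IsOrderedModule ℝ E]

theorem IsKBSpace.tendsto_of_uawTendsto (h : IsKBSpace E) {φ : StrongDual ℝ (StrongDual ℝ E)}
    (hφ : BidualNonneg φ) {ι : Type*} {l : Filter ι} {x : ι → E} (hxφ : ∀ i, x i ∈ bInterval φ)
    {a : E} (hx : UawTendsto x l a) : Tendsto x l (𝓝 a) := by
  let ψ : StrongDual ℝ (StrongDual ℝ E) := φ + NormedSpace.inclusionInDoubleDual ℝ E |a|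
  have hψ : BidualNonneg ψ := fun f hf =>
    add_nonneg (hφ f hf) (bidualNonneg_inclusion (abs_nonneg a) f hf)
  have hxψ : ∀ i, x i - a ∈ bInterval ψ := fun i => by
    refine mem_bInterval_iff_abs.2 (dominatedBy_zero_iff.2 fun f hf => ?_)
    calc f |x i - a| ≤ f (|x i| + |a|) := hf.monotone (by
          simpa only [sub_eq_add_neg, abs_neg] using abs_add_le (x i) (-a))
      _ = f |x i| + f |a| := map_add f _ _
      _ ≤ φ f + f |a| := by
          gcongr
          exact dominatedBy_zero_iff.1 (mem_bInterval_iff_abs.1 (hxφ i)) f hf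
  exact tendsto_sub_nhds_zero_iff.1 (hx.sub_const.tendsto_zero_of_forall_norm_le_inf
    (fun ε hε => h.exists_norm_le_inf hε hψ) hxψ)

theorem HasUawSubnetTendsto.exists_subseq_tendsto (h : IsKBSpace E) {A : Set E}
    (hA : IsBOrderBounded A) {x : ℕ → E} (hxA : ∀ n, x n ∈ A) {a : E}
    (hx : HasUawSubnetTendsto (fun i : ULift.{u} ℕ => x i.down) a) :
    ∃ σ : ℕ → ℕ, StrictMono σ ∧ Tendsto (x ∘ σ) atTop (𝓝 a) := by
  obtain ⟨φ, hφ, hAφ⟩ := hA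
  obtain ⟨κ, _, _, _, ψ, hψ, hlim⟩ := hx
  have hdown : Tendsto (fun k => (ψ k).down) atTop atTop :=
    tendsto_atTop.2 fun n => tendsto_atTop.1 hψ ⟨n⟩
  exact MapClusterPt.tendsto_subseq (MapClusterPt.of_comp hdown
    (h.tendsto_of_uawTendsto hφ (fun k => hAφ (hxA (ψ k).down)) hlim).mapClusterPt)

theorem IsKBSpace.isCompact_of_isUawCompact (h : IsKBSpace E) {A : Set E}
    (hA : IsBOrderBounded A) (hu : IsUawCompact A) : IsCompact A := by
  refine IsSeqCompact.isCompact fun x hx => ?_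
  obtain ⟨a, ha, hxa⟩ := hu.2 (ULift.{u} ℕ) (fun i => x i.down) fun i => hx _
  exact ⟨a, ha, hxa.exists_subseq_tendsto h hA hx⟩

theorem IsKBSpace.isCompact_closure_of_isRelUawCompact (h : IsKBSpace E) {A : Set E}
    (hA : IsBOrderBounded A) (hu : IsRelUawCompact A) : IsCompact (closure A) := by
  refine IsSeqCompact.isCompact fun x hx => ?_
  choose y hyA hy using fun n : ℕ => Metric.mem_closure_iff.1 (hx n) (1 / ((n : ℝ) + 1))
    Nat.one_div_pos_of_nat
  obtain ⟨a, hya⟩ := hu.2 (ULift.{u} ℕ) (fun i => y i.down) fun i => hyA _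
  obtain ⟨σ, hσ, hlim⟩ := hya.exists_subseq_tendsto h hA hyA
  have hdist : Tendsto (fun n => dist (y (σ n)) (x (σ n))) atTop (𝓝 0) :=
    squeeze_zero (fun n => dist_nonneg) (fun n => (dist_comm _ _).trans_le (hy (σ n)).le)
      (tendsto_one_div_add_atTop_nhds_zero_nat.comp hσ.tendsto_atTop)
  exact ⟨a, mem_closure_of_tendsto hlim (Eventually.of_forall fun n => hyA _), σ, hσ,
    hlim.congr_dist hdist⟩

theorem UawTendsto.eq_zero_of_tendsto {ι : Type*} {l : Filter ι} [l.NeBot] {x : ι → E}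
    (hx : UawTendsto x l 0) {a : E} (ha : Tendsto x l (𝓝 a)) : a = 0 := by
  obtain ⟨f, -, -, hf⟩ := exists_dualNonneg_apply_eq_norm (abs_nonneg a)
  have hcont : Continuous fun z : E => f (|z - 0| ⊓ |a|) := by
    simp only [abs]
    fun_prop
  have hfa := tendsto_nhds_unique (hx |a| (abs_nonneg a) f) ((hcont.tendsto a).comp ha)
  rw [sub_zero, inf_idem, hf, norm_abs_eq_norm] at hfa
  exact norm_eq_zero.1 hfa.symm

theorem UawTendsto.tendsto_zero_of_isCompact {x : ℕ → E} (hx : UawTendsto x atTop 0) {K : Set E}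
    (hK : IsCompact K) (hxK : ∀ n, x n ∈ K) : Tendsto x atTop (𝓝 0) := by
  refine hK.tendsto_nhds_of_unique_mapClusterPt (Eventually.of_forall hxK) fun a _ ha => ?_
  obtain ⟨σ, hσ, hlim⟩ := MapClusterPt.tendsto_subseq ha
  exact (hx.comp hσ.tendsto_atTop).eq_zero_of_tendsto hlim

theorem tendsto_zero_of_forall_isUawCompact
    (h : ∀ A : Set E, IsBOrderBounded A → IsUawCompact A → ∃ K, IsCompact K ∧ A ⊆ K)
    {φ : StrongDual ℝ (StrongDual ℝ E)} (hφ : BidualNonneg φ) {x : ℕ → E}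
    (hxφ : ∀ n, x n ∈ bInterval φ) (hx : UawTendsto x atTop 0) : Tendsto x atTop (𝓝 0) := by
  have hrange : Set.range x ⊆ bInterval φ := Set.range_subset_iff.2 hxφ
  have hzero : (0 : E) ∈ bInterval φ :=
    mem_bInterval_iff_abs.2 (by rw [abs_zero]; exact hφ.dominatedBy_zero)
  obtain ⟨K, hK, hAK⟩ := h _ ⟨φ, hφ, Set.insert_subset hzero hrange⟩
    (isUawCompact_insert_zero_range (isBounded_bInterval.subset hrange) hx)
  exact hx.tendsto_zero_of_isCompact hK fun n => hAK (Set.mem_insert_of_mem _ ⟨n, rfl⟩)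

end UawCompact

end BanachLattice

open BanachLattice

theorem corollary3p15 {E : Type u} [NormedAddCommGroup E] [NormedSpace ℝ E] [CompleteSpace E]
    [Lattice E] [IsOrderedAddMonoid E] [IsOrderedModule ℝ E] [HasSolidNorm E] :
    List.TFAE [
      BanachLattice.IsKBSpace E,
      ∀ S : Set E, BanachLattice.IsBSemiCompact S → BanachLattice.IsLWeaklyCompact S,
      ∀ φ : StrongDual ℝ (StrongDual ℝ E), BanachLattice.BidualNonneg φ →
        BanachLattice.IsLwcOn (BanachLattice.bInterval φ) (ContinuousLinearMap.id ℝ E),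
      ∀ ε : ℝ, 0 < ε → ∀ φ : StrongDual ℝ (StrongDual ℝ E), BanachLattice.BidualNonneg φ →
        ∃ (g : StrongDual ℝ E) (y : E), BanachLattice.DualNonneg g ∧ 0 ≤ y ∧
          ∀ x ∈ BanachLattice.bInterval φ, ‖x‖ ≤ g (|x| ⊓ y) + ε,
      ∀ φ : StrongDual ℝ (StrongDual ℝ E), BanachLattice.BidualNonneg φ →
        ∀ (ι : Type w) [Preorder ι] [IsDirectedOrder ι] [Nonempty ι] (x : ι → E),
          (∀ i, x i ∈ BanachLattice.bInterval φ) → BanachLattice.UawTendsto x atTop 0 →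
            Tendsto x atTop (𝓝 0),
      ∀ φ : StrongDual ℝ (StrongDual ℝ E), BanachLattice.BidualNonneg φ →
        ∀ x : ℕ → E, (∀ n, x n ∈ BanachLattice.bInterval φ) →
          BanachLattice.UawTendsto x atTop 0 → Tendsto x atTop (𝓝 0),
      ∀ A : Set E, BanachLattice.IsBOrderBounded A → BanachLattice.IsUawCompact A → IsCompact A,
      ∀ A : Set E, BanachLattice.IsBOrderBounded A → BanachLattice.IsRelUawCompact A →
        IsCompact (closure A)] := by
  tfae_have 1 → 2 := fun h _ hS => h.isLWeaklyCompact hS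
  tfae_have 2 → 1 := fun h =>
    isKBSpace_of_isLWeaklyCompact_bInterval fun _ hφ => h _ (isBSemiCompact_bInterval hφ)
  tfae_have 1 → 4 := fun h _ hε _ hφ => h.exists_norm_le_inf hε hφ
  tfae_have 4 → 5 := fun h φ hφ _ _ _ _ _ hxφ hx =>
    hx.tendsto_zero_of_forall_norm_le_inf (fun ε hε => h ε hε φ hφ) hxφ
  tfae_have 5 → 6 := fun h φ hφ _ hxφ hx => tendsto_zero_of_forall_net (h φ hφ) hxφ hx
  tfae_have 6 → 1 := isKBSpace_of_forall_uawTendsto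
  tfae_have 6 → 3 := fun h φ hφ => ⟨isBounded_bInterval, fun x hxφ hx =>
    h φ hφ x (fun n => solidClosure_bInterval_subset (hxφ n)) hx⟩
  tfae_have 3 → 6 := fun h φ hφ x hxφ hx =>
    (h φ hφ).2 x (fun n => subset_solidClosure_self _ (hxφ n)) hx
  tfae_have 1 → 7 := fun h _ hA hu => h.isCompact_of_isUawCompact hA hu
  tfae_have 1 → 8 := fun h _ hA hu => h.isCompact_closure_of_isRelUawCompact hA hu
  tfae_have 7 → 6 := fun h _ hφ _ hxφ hx => tendsto_zero_of_forall_isUawCompact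
    (fun A hA hu => ⟨A, h A hA hu, subset_rfl⟩) hφ hxφ hx
  tfae_have 8 → 6 := fun h _ hφ _ hxφ hx => tendsto_zero_of_forall_isUawCompact
    (fun A hA hu => ⟨closure A, h A hA hu.isRelUawCompact, subset_closure⟩) hφ hxφ hx
  tfae_finish
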